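/- Let $(A,\mathfrak m)$ be a commutative Noetherian local ring, $\mathfrak q\subsetneq A$ a proper ideal, $M$ a finitely generated $A$-module, and $\underline a=a_1,\dots,a_t$ a system of parameters of $M$ (that is, $a_i\in\mathfrak m$, $t=\dim M$ and $M/\underline aM$ has finite length), where $a_i\in\mathfrak q^{c_i}$ with integers $c_i\ge 0$ for $i=1,\dots,t$. For $S\subseteq\{1,\dots,t\}$ put $a_S=\prod_{j\in S}a_j$ and $c_S=\sum_{j\in S}c_j$, and let $M[\mathfrak q^{c_S}/a_S]\subseteq M_{a_S}$ be the $A$-submodule generated by all $xm/a_S^k$ with $k\ge 0$, $x\in\mathfrak q^{kc_S}$, $m\in M$. For $n\in\mathbb N$ the modules $\check C^i(\underline a,\mathfrak q,M;n)=\bigoplus_{|S|=i}\mathfrak q^nM[\mathfrak q^{c_S}/a_S]$ form a subcomplex of the Čech complex $\check C_{\underline a}\otimes_AM$, whose $i$-th term is $\bigoplus_{|S|=i}M_{a_S}$. Let $\check{\mathcal L}^\bullet(\underline a,\mathfrak q,M;n)$ be the quotient complex and $\check L^i(\underline a,\mathfrak q,M;n)$ its $i$-th cohomology. Let $G_A(\mathfrak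 q)=\bigoplus_{n\ge0}\mathfrak q^n/\mathfrak q^{n+1}$, let $G_A(\mathfrak q)_+$ be its ideal of elements of positive degree, and for a finitely generated $A$-module $N$ let $G_N(\mathfrak q)=\bigoplus_{n\ge0}\mathfrak q^nN/\mathfrak q^{n+1}N$, a $G_A(\mathfrak q)$-module. Let $a_i^\star=a_i+\mathfrak q^{c_i+1}\in\mathfrak q^{c_i}/\mathfrak q^{c_i+1}=[G_A(\mathfrak q)]_{c_i}$. Suppose that condition $(\star)$ holds: for all $i=1,\dots,t$, $$a_i^\star\notin\mathfrak P\quad\text{for all }\mathfrak P\in\operatorname{Ass}_{G_A(\mathfrak q)}G_{M/(a_1,\dots,a_{i-1})M}(\mathfrak q)\text{ with }\mathfrak P\not\supseteq G_A(\mathfrak q)_+ .$$ Then there is an isomorphism of $A$-modules $$H^t_{\underline a}(M)\cong\check L^t(\underline a,\mathfrak q,M;n)\qquad\text{for all }n\gg0,$$ where $H^t_{\underline a}(M)$ is the $t$-th local cohomology module of $M$ with respect to the ideal $\underline aA$. In particular, if $H^t_{\underline a}(M)\ne0$, then $\check L^t(\underline a,\mathfrak q,M;n)\neq 0$ for all $n\gg0$.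 -/

import Mathlib

set_option maxSynthPendingDepth 3

open CategoryTheory

universe u

noncomputable section

namespace ModCech

/-! ### Local cohomology: right derived functors of the section functor -/

section LocalCohomology

variable {A : Type u} [CommRing A]

/-- The section functor on modules: `Γ_I(M) = {m ∈ M | Supp (A m) ⊆ V(I)}`. -/
def gammaSubmodule (I : Ideal A) (M : Type u) [AddCommGroup M] [Module A M] : Submodule A M where
  carrier := {m | Module.support A (Submodule.span A {m}) ⊆ PrimeSpectrum.zeroLocus (I : Set A)}
  zero_mem' := by
    intro p hp
    have : Subsingleton (Submodule.span A {(0 : M)}) := by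
      rw [Submodule.span_zero_singleton]
      infer_instance
    rw [Module.support_eq_empty] at hp
    exact hp.elim
  add_mem' := by
    intro x y hx hy p hp
    by_contra hpI
    have h1 : ∀ {z : M}, p ∉ Module.support A (Submodule.span A {z}) →
        ∃ r ∉ p.asIdeal, r • z = 0 := by
      intro z hz
      rw [Module.notMem_support_iff'] at hz
      obtain ⟨r, hr, h⟩ := hz ⟨z, Submodule.mem_span_singleton_self z⟩
      exact ⟨r, hr, congrArg Subtype.val h⟩
    obtain ⟨r, hr, hrx⟩ := h1 (fun h => hpI (hx h))
    obtain ⟨s, hs, hsy⟩ := h1 (fun h => hpI (hy h))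
    refine absurd hp (Module.notMem_support_iff'.2 ?_)
    rintro ⟨m, hm⟩
    obtain ⟨b, rfl⟩ := Submodule.mem_span_singleton.1 hm
    refine ⟨r * s, fun h => (p.isPrime.mem_or_mem h).elim hr hs, Subtype.ext ?_⟩
    change (r * s) • b • (x + y) = 0
    have e : (r * s) • b • (x + y) = (b * s) • r • x + (b * r) • s • y := by
      simp only [smul_add, smul_smul]
      congr 2 <;> ring
    rw [e, hrx, hsy, smul_zero, smul_zero, add_zero]
  smul_mem' := by
    intro r x hx
    refine Set.Subset.trans (Module.support_subset_of_injective
      (Submodule.inclusion (?_ : Submodule.span A {r • x} ≤ Submodule.span A {x}))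
      (Submodule.inclusion_injective _)) hx
    rw [Submodule.span_singleton_le_iff_mem]
    exact Submodule.smul_mem _ _ (Submodule.mem_span_singleton_self x)

lemma map_mem_gammaSubmodule (I : Ideal A) {M N : Type u} [AddCommGroup M] [Module A M]
    [AddCommGroup N] [Module A N] (f : M →ₗ[A] N) (m : M) (hm : m ∈ gammaSubmodule I M) :
    f m ∈ gammaSubmodule I N := by
  have hg : ∀ x ∈ Submodule.span A {m}, f x ∈ Submodule.span A {f m} := by
    intro x hx
    obtain ⟨b, rfl⟩ := Submodule.mem_span_singleton.1 hx
    rw [map_smul]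
    exact Submodule.smul_mem _ _ (Submodule.mem_span_singleton_self _)
  refine Set.Subset.trans (Module.support_subset_of_surjective (f.restrict hg) ?_) hm
  rintro ⟨y, hy⟩
  obtain ⟨b, rfl⟩ := Submodule.mem_span_singleton.1 hy
  exact ⟨⟨b • m, Submodule.smul_mem _ _ (Submodule.mem_span_singleton_self _)⟩,
    Subtype.ext (map_smul f b m)⟩

/-- The section functor `Γ_I` on the category of `A`-modules. -/
def gammaFunctor (I : Ideal A) : ModuleCat.{u} A ⥤ ModuleCat.{u} A where
  obj M := ModuleCat.of A (gammaSubmodule I M)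
  map f := ModuleCat.ofHom (f.hom.restrict (map_mem_gammaSubmodule I f.hom))
  map_id _ := rfl
  map_comp _ _ := rfl

instance (I : Ideal A) : (gammaFunctor I).Additive where
  map_add := rfl

/-- The local cohomology module `H^i_I(M)`, the `i`-th right derived functor of `Γ_I` at `M`. -/
abbrev LocalCohomologyModule (I : Ideal A) (i : ℕ) (M : Type u) [AddCommGroup M] [Module A M] :
    Type u :=
  ((gammaFunctor I).rightDerived i).obj (ModuleCat.of A M)

end LocalCohomology

/-! ### The form ring, the form module, and condition `(⋆)` -/

section FormModule

variable {A : Type u} [CommRing A] (q : Ideal A) (M : Type u) [AddCommGroup M] [Module A M]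

/-- The Rees module `R_M(q) = ⨁ qⁿM Tⁿ ⊆ M[T]` over the Rees ring `R_A(q) = ⨁ qⁿ Tⁿ ⊆ A[T]`. -/
abbrev reesModule : Submodule (reesAlgebra q) (PolynomialModule A M) :=
  (q.stableFiltration (⊤ : Submodule A M)).submodule

/-- The ideal `⨁ qⁿ⁺¹ Tⁿ` of the Rees ring. -/
def shiftIdeal : Ideal (reesAlgebra q) where
  carrier := {f | ∀ n, (f : Polynomial A).coeff n ∈ q ^ (n + 1)}
  zero_mem' n := by simp
  add_mem' hf hg n := by simpa using add_mem (hf n) (hg n)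
  smul_mem' := by
    intro f g hg n
    change ((f : Polynomial A) * (g : Polynomial A)).coeff n ∈ q ^ (n + 1)
    rw [Polynomial.coeff_mul]
    refine sum_mem fun x hx => ?_
    rw [← Finset.HasAntidiagonal.mem_antidiagonal.1 hx, add_assoc, pow_add]
    exact Ideal.mul_mem_mul (f.2 x.1) (hg x.2)

/-- The submodule `⨁ qⁿ⁺¹M Tⁿ` of the Rees module. -/
def shiftSubmodule : Submodule (reesAlgebra q) (reesModule q M) where
  carrier := {f | ∀ n, (f : PolynomialModule A M).coeff n ∈ q ^ (n + 1) • (⊤ : Submodule A M)}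
  zero_mem' n := by simp
  add_mem' hf hg n := by simpa using add_mem (hf n) (hg n)
  smul_mem' := by
    intro f g hg n
    change ((f : Polynomial A) • (g : PolynomialModule A M)).coeff n ∈ _
    rw [PolynomialModule.smul_apply]
    refine sum_mem fun x hx => ?_
    rw [← Finset.HasAntidiagonal.mem_antidiagonal.1 hx, add_assoc, pow_add, mul_smul]
    exact Submodule.smul_mem_smul (f.2 x.1) (hg x.2)

/-- The form ring `G_A(q) = ⨁ qⁿ/qⁿ⁺¹`, as the quotient of `⨁ qⁿ Tⁿ` by `⨁ qⁿ⁺¹ Tⁿ`. -/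
abbrev FormRing : Type u := reesAlgebra q ⧸ shiftIdeal q

/-- The form module `G_M(q) = ⨁ qⁿM/qⁿ⁺¹M`, as the quotient of `⨁ qⁿM Tⁿ` by `⨁ qⁿ⁺¹M Tⁿ`. -/
abbrev FormModule : Type u := reesModule q M ⧸ shiftSubmodule q M

lemma formModule_isTorsionBySet :
    Module.IsTorsionBySet (reesAlgebra q) (FormModule q M) (shiftIdeal q : Set (reesAlgebra q)) := by
  rintro x ⟨f, hf⟩
  obtain ⟨g, rfl⟩ := Submodule.Quotient.mk_surjective _ x
  change f • Submodule.Quotient.mk g = 0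
  rw [← Submodule.Quotient.mk_smul, Submodule.Quotient.mk_eq_zero]
  intro n
  change ((f : Polynomial A) • (g : PolynomialModule A M)).coeff n ∈ _
  rw [PolynomialModule.smul_apply]
  refine sum_mem fun x hx => ?_
  have hg : (g : PolynomialModule A M).coeff x.2 ∈ q ^ x.2 • (⊤ : Submodule A M) := g.2 x.2
  rw [← Finset.HasAntidiagonal.mem_antidiagonal.1 hx, add_right_comm, pow_add, mul_smul]
  exact Submodule.smul_mem_smul (hf x.1) hg

/-- The action of `G_A(q)` on `G_M(q)` induced by that of `R_A(q)` on `R_M(q)`. -/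
instance formModuleModule : Module (FormRing q) (FormModule q M) :=
  (formModule_isTorsionBySet q M).module

/-- The irrelevant ideal `G_A(q)₊`, consisting of the classes of the Rees elements
without constant term. -/
def irrelevantIdeal : Ideal (FormRing q) :=
  Ideal.map (Ideal.Quotient.mk (shiftIdeal q))
    (RingHom.ker ((Polynomial.constantCoeff : Polynomial A →+* A).comp
      (reesAlgebra q).val.toRingHom))

variable {q}

/-- For `x ∈ q^c`, the class `x⋆ = x + q^{c+1}` in `[G_A(q)]_c = q^c/q^{c+1}`. -/
def initialForm {c : ℕ} {x : A} (hx : x ∈ q ^ c) : FormRing q :=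
  Ideal.Quotient.mk (shiftIdeal q) ⟨Polynomial.monomial c x, reesAlgebra.monomial_mem.2 hx⟩

/-- Condition `(⋆)`: for each `i`, the form `a_i⋆` lies in none of the associated primes of
`G_{M/(a_1,…,a_{i-1})M}(q)` outside `V(G_A(q)₊)`. -/
def ConditionStar {t : ℕ} {a : Fin t → A} {c : Fin t → ℕ} (hac : ∀ i, a i ∈ q ^ c i) : Prop :=
  ∀ i : Fin t,
    ∀ P ∈ associatedPrimes (FormRing q)
      (FormModule q (M ⧸ (Ideal.span (a '' {j | j < i}) • (⊤ : Submodule A M)))),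
    ¬ irrelevantIdeal q ≤ P → initialForm (hac i) ∉ P

end FormModule

/-- `a_1,…,a_t` is a system of parameters of `M`: elements of the maximal ideal,
`t = dim M`, and `M/(a_1,…,a_t)M` has finite length. -/
def IsSystemOfParameters {A : Type u} [CommRing A] [IsLocalRing A] (M : Type u) [AddCommGroup M]
    [Module A M] {t : ℕ} (a : Fin t → A) : Prop :=
  (∀ i, a i ∈ IsLocalRing.maximalIdeal A) ∧ Module.supportDim A M = t ∧
    IsFiniteLength A (M ⧸ (Ideal.span (Set.range a) • (⊤ : Submodule A M)))

/-! ### The Čech complex and the modified complexes -/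

section Cech

variable {A : Type u} [CommRing A] {t : ℕ}

/-- The product `a_S = ∏_{j ∈ S} a_j`. -/
abbrev prodElt (a : Fin t → A) (S : Finset (Fin t)) : A := ∏ j ∈ S, a j

variable (a : Fin t → A) (M : Type u) [AddCommGroup M] [Module A M]

/-- The localization `M_{a_S}`. -/
abbrev CechLoc (S : Finset (Fin t)) : Type u :=
  LocalizedModule (Submonoid.powers (prodElt a S)) M

variable {M} in
/-- The fraction `m / a_S^k` in `M_{a_S}`. -/
abbrev frac (S : Finset (Fin t)) (m : M) (k : ℕ) : CechLoc a M S :=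
  LocalizedModule.mk m ⟨prodElt a S ^ k, pow_mem (Submonoid.mem_powers _) k⟩

lemma isUnit_prodElt {S T : Finset (Fin t)} (h : S ⊆ T)
    (x : Submonoid.powers (prodElt a S)) :
    IsUnit (algebraMap A (Module.End A (CechLoc a M T)) x) := by
  obtain ⟨_, k, rfl⟩ := x
  have hT : IsUnit (algebraMap A (Module.End A (CechLoc a M T)) (prodElt a T)) :=
    IsLocalizedModule.map_units (S := Submonoid.powers (prodElt a T))
      (LocalizedModule.mkLinearMap (Submonoid.powers (prodElt a T)) M)
      ⟨prodElt a T, Submonoid.mem_powers _⟩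
  have hp : prodElt a T = prodElt a (T \ S) * prodElt a S := (Finset.prod_sdiff h).symm
  have hm : algebraMap A (Module.End A (CechLoc a M T)) (prodElt a T) =
      algebraMap A (Module.End A (CechLoc a M T)) (prodElt a (T \ S)) *
        algebraMap A (Module.End A (CechLoc a M T)) (prodElt a S) := by
    rw [← map_mul]
    exact congrArg _ hp
  rw [hm, Commute.isUnit_mul_iff
    (by rw [commute_iff_eq, ← map_mul, ← map_mul, mul_comm])] at hT
  change IsUnit (algebraMap A (Module.End A (CechLoc a M T)) (prodElt a S ^ k))
  rw [map_pow]
  exact hT.2.pow k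

/-- The natural map `M_{a_S} → M_{a_T}` for `S ⊆ T`. -/
def cechRestrict {S T : Finset (Fin t)} (h : S ⊆ T) : CechLoc a M S →ₗ[A] CechLoc a M T :=
  LocalizedModule.lift (Submonoid.powers (prodElt a S))
    (LocalizedModule.mkLinearMap (Submonoid.powers (prodElt a T)) M) (isUnit_prodElt a M h)

variable {M} in
lemma cechRestrict_frac {S T : Finset (Fin t)} (h : S ⊆ T) (m : M) (k : ℕ) :
    cechRestrict a M h (frac a S m k) = frac a T (prodElt a (T \ S) ^ k • m) k := by
  have hp : prodElt a T = prodElt a S * prodElt a (T \ S) := by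
    rw [mul_comm]
    exact (Finset.prod_sdiff h).symm
  rw [cechRestrict, LocalizedModule.lift_mk, Module.End.algebraMap_isUnit_inv_apply_eq_iff,
    LocalizedModule.mkLinearMap_apply]
  change _ = (prodElt a S ^ k) • _
  rw [LocalizedModule.smul'_mk, LocalizedModule.mk_eq]
  refine ⟨1, ?_⟩
  simp only [one_smul, Submonoid.smul_def, smul_smul]
  rw [hp, mul_pow]

lemma exists_frac (S : Finset (Fin t)) (z : CechLoc a M S) : ∃ m k, z = frac a S m k := by
  induction z using LocalizedModule.induction_on with
  | h m s =>
    obtain ⟨_, k, rfl⟩ := s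
    exact ⟨m, k, rfl⟩

lemma cechRestrict_comp {S T U : Finset (Fin t)} (h : S ⊆ T) (h' : T ⊆ U) (z : CechLoc a M S) :
    cechRestrict a M h' (cechRestrict a M h z) = cechRestrict a M (h.trans h') z := by
  obtain ⟨m, k, rfl⟩ := exists_frac a M S z
  rw [cechRestrict_frac, cechRestrict_frac, cechRestrict_frac, smul_smul, ← mul_pow]
  congr 3
  rw [← Finset.prod_union (Finset.disjoint_left.2 (by simp +contextual))]
  congr 1
  ext x
  have := @h x
  have := @h' x
  simp only [Finset.mem_union, Finset.mem_sdiff]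
  tauto

/-- `Č^i_a(M) = ⨁_{j_1 < ⋯ < j_i} M_{a_{j_1}⋯a_{j_i}}`. -/
abbrev CechTerm (i : ℕ) : Type u :=
  (S : {S : Finset (Fin t) // S.card = i}) → CechLoc a M S.1

/-- The Čech differential: the component at `T = {j_1 < ⋯ < j_{i+1}}` is the sum over `k` of
`(-1)^{k+1}` times the natural map from the component at `T ∖ {j_k}`. -/
def cechD (i : ℕ) : CechTerm a M i →ₗ[A] CechTerm a M (i + 1) :=
  LinearMap.pi fun T => ∑ j : {j // j ∈ T.1},
    ((-1 : A) ^ (T.1.filter (· < j.1)).card) •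
      (cechRestrict a M (Finset.erase_subset j.1 T.1) ∘ₗ
        LinearMap.proj (⟨T.1.erase j.1, by rw [Finset.card_erase_of_mem j.2, T.2]; rfl⟩ :
          {S : Finset (Fin t) // S.card = i}))

lemma cechD_apply (i : ℕ) (x : CechTerm a M i) (T : {T : Finset (Fin t) // T.card = i + 1}) :
    cechD a M i x T = ∑ j : {j // j ∈ T.1}, ((-1 : A) ^ (T.1.filter (· < j.1)).card) •
      cechRestrict a M (Finset.erase_subset j.1 T.1)
        (x ⟨T.1.erase j.1, by rw [Finset.card_erase_of_mem j.2, T.2]; rfl⟩) := by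
  simp [cechD]

variable (q : Ideal A) (c : Fin t → ℕ) (n : ℕ)

/-- `M[q^{c_S}/a_S] ⊆ M_{a_S}`, where `c_S = ∑_{j ∈ S} c_j`: the sums of elements `x m / a_S^k`
with `x ∈ q^{k c_S}` and `m ∈ M`. -/
def blowup (S : Finset (Fin t)) : Submodule A (CechLoc a M S) :=
  Submodule.span A {y | ∃ k : ℕ, ∃ x ∈ q ^ (k * ∑ j ∈ S, c j), ∃ m : M, y = frac a S (x • m) k}

/-- `Č^i(a,q,M;n) = ⨁ qⁿ M[q^{c_S}/a_S]`, as a submodule of `Č^i_a(M)`. -/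
def modCechTerm (i : ℕ) : Submodule A (CechTerm a M i) :=
  Submodule.pi Set.univ fun S => q ^ n • blowup a M q c S.1

variable {q c}

variable {a M n} in
lemma mem_modCechTerm {i : ℕ} {x : CechTerm a M i} :
    x ∈ modCechTerm a M q c n i ↔ ∀ S, x S ∈ q ^ n • blowup a M q c S.1 :=
  ⟨fun h S => h S (Set.mem_univ S), fun h S _ => h S⟩

lemma prodElt_mem (hac : ∀ i, a i ∈ q ^ c i) (S : Finset (Fin t)) :
    prodElt a S ∈ q ^ ∑ j ∈ S, c j := by
  rw [← Finset.prod_pow_eq_pow_sum]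
  exact Ideal.prod_mem_prod fun j _ => hac j

lemma cechRestrict_mem (hac : ∀ i, a i ∈ q ^ c i) {S T : Finset (Fin t)} (h : S ⊆ T)
    {z : CechLoc a M S} (hz : z ∈ q ^ n • blowup a M q c S) :
    cechRestrict a M h z ∈ q ^ n • blowup a M q c T := by
  suffices hle : (blowup a M q c S).map (cechRestrict a M h) ≤ blowup a M q c T by
    have := Submodule.mem_map_of_mem (f := cechRestrict a M h) hz
    rw [Submodule.map_smul''] at this
    exact smul_mono_right (q ^ n) hle this
  rw [blowup, Submodule.map_span, Submodule.span_le]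
  rintro _ ⟨_, ⟨k, x, hx, m, rfl⟩, rfl⟩
  rw [cechRestrict_frac]
  refine Submodule.subset_span ⟨k, prodElt a (T \ S) ^ k * x, ?_, m, by rw [mul_smul]⟩
  rw [← Finset.sum_sdiff h, mul_add, pow_add]
  refine Ideal.mul_mem_mul ?_ hx
  rw [mul_comm, pow_mul]
  exact Ideal.pow_mem_pow (prodElt_mem a hac _) k

/-- The Čech differential maps `Č^i(a,q,M;n)` into `Č^{i+1}(a,q,M;n)`. -/
lemma modCechTerm_le_comap (hac : ∀ i, a i ∈ q ^ c i) (i : ℕ) :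
    modCechTerm a M q c n i ≤ (modCechTerm a M q c n (i + 1)).comap (cechD a M i) := by
  intro x hx
  rw [mem_modCechTerm] at hx
  rw [Submodule.mem_comap, mem_modCechTerm]
  intro T
  rw [cechD_apply]
  refine Submodule.sum_mem _ fun j _ => ?_
  have h := hx ⟨T.1.erase j.1, by rw [Finset.card_erase_of_mem j.2, T.2]; rfl⟩
  exact Submodule.smul_mem _ _ (cechRestrict_mem a M n hac (Finset.erase_subset j.1 T.1) h)

lemma cechD_comp_cechD (i : ℕ) : cechD a M (i + 1) ∘ₗ cechD a M i = 0 := by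
  refine LinearMap.ext fun x => funext fun U => ?_
  rw [LinearMap.comp_apply, cechD_apply]
  let f : Finset (Fin t) → CechLoc a M U.1 := fun V =>
    if h : V.card = i ∧ V ⊆ U.1 then cechRestrict a M h.2 (x ⟨V, h.1⟩) else 0
  let e : Finset (Fin t) → Fin t → ℕ := fun V j => (V.filter (· < j)).card
  have h1 : ∀ j : {j // j ∈ U.1}, ((-1 : A) ^ (U.1.filter (· < j.1)).card) •
      cechRestrict a M (Finset.erase_subset j.1 U.1) (cechD a M i x
        ⟨U.1.erase j.1, by rw [Finset.card_erase_of_mem j.2, U.2]; rfl⟩) =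
      ∑ k ∈ U.1.erase j.1, ((-1 : A) ^ (e U.1 j.1 + e (U.1.erase j.1) k)) •
        f ((U.1.erase j.1).erase k) := by
    intro j
    rw [cechD_apply, map_sum, Finset.smul_sum, ← Finset.sum_coe_sort (U.1.erase j.1)
      fun k => ((-1 : A) ^ (e U.1 j.1 + e (U.1.erase j.1) k)) • f ((U.1.erase j.1).erase k)]
    refine Finset.sum_congr rfl fun k _ => ?_
    rw [map_smul, cechRestrict_comp, smul_smul, ← pow_add]
    have hk : ((U.1.erase j.1).erase k.1).card = i ∧ (U.1.erase j.1).erase k.1 ⊆ U.1 := by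
      refine ⟨?_, (Finset.erase_subset _ _).trans (Finset.erase_subset _ _)⟩
      rw [Finset.card_erase_of_mem k.2, Finset.card_erase_of_mem j.2, U.2]
      rfl
    simp only [f, e, dif_pos hk]
  rw [Finset.sum_congr rfl fun j _ => h1 j,
    Finset.sum_coe_sort U.1 fun j => ∑ k ∈ U.1.erase j,
      ((-1 : A) ^ (e U.1 j + e (U.1.erase j) k)) • f ((U.1.erase j).erase k),
    Finset.sum_sigma']
  have h2 : ∀ j k, j ∈ U.1 → k ∈ U.1 → j < k →
      ((-1 : A) ^ (e U.1 j + e (U.1.erase j) k)) • f ((U.1.erase j).erase k) +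
      ((-1 : A) ^ (e U.1 k + e (U.1.erase k) j)) • f ((U.1.erase k).erase j) = 0 := by
    intro j k hj hk hjk
    have e1 : e (U.1.erase k) j = e U.1 j := by
      simp only [e, Finset.filter_erase]
      rw [Finset.erase_eq_of_notMem (by simp [hjk.le])]
    have e2 : e U.1 k = e (U.1.erase j) k + 1 := by
      simp only [e, Finset.filter_erase]
      rw [Finset.card_erase_add_one (by simp [hj, hjk])]
    rw [Finset.erase_right_comm, ← add_smul, e1, e2]
    rw [show (-1 : A) ^ (e U.1 j + e (U.1.erase j) k) +
      (-1) ^ (e (U.1.erase j) k + 1 + e U.1 j) = 0 by ring, zero_smul]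
  refine Finset.sum_involution (fun p _ => ⟨p.2, p.1⟩) ?_ ?_ ?_ ?_
  · rintro ⟨j, k⟩ hp
    simp only [Finset.mem_sigma, Finset.mem_erase] at hp
    rcases lt_trichotomy j k with h | h | h
    · exact h2 j k hp.1 hp.2.2 h
    · exact absurd h.symm hp.2.1
    · exact (add_comm _ _).trans (h2 k j hp.2.2 hp.1 h)
  · rintro ⟨j, k⟩ hp _ he
    simp only [Finset.mem_sigma, Finset.mem_erase] at hp
    exact hp.2.1 (congrArg Sigma.fst he)
  · rintro ⟨j, k⟩ hp
    simp only [Finset.mem_sigma, Finset.mem_erase] at hp ⊢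
    exact ⟨hp.2.2, fun h => hp.2.1 h.symm, hp.1⟩
  · rintro ⟨j, k⟩ _
    rfl

variable (q c)

/-- `𝓛^i(a,q,M;n)`, the quotient of `Č^i_a(M)` by `Č^i(a,q,M;n)`. -/
abbrev LTerm (i : ℕ) : Type u := CechTerm a M i ⧸ modCechTerm a M q c n i

variable {q c}

/-- The differential of `𝓛(a,q,M;n)`, induced by the Čech differential. -/
def LD (hac : ∀ i, a i ∈ q ^ c i) (i : ℕ) : LTerm a M q c n i →ₗ[A] LTerm a M q c n (i + 1) :=
  Submodule.mapQ _ _ (cechD a M i) (modCechTerm_le_comap a M n hac i)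

lemma LD_comp_LD (hac : ∀ i, a i ∈ q ^ c i) (i : ℕ) :
    LD a M n hac (i + 1) ∘ₗ LD a M n hac i = 0 := by
  refine Submodule.linearMap_qext _ (LinearMap.ext fun x => ?_)
  have h : cechD a M (i + 1) (cechD a M i x) = 0 := LinearMap.congr_fun (cechD_comp_cechD a M i) x
  change Submodule.Quotient.mk (cechD a M (i + 1) (cechD a M i x)) = 0
  rw [h, Submodule.Quotient.mk_zero]

/-- The coboundaries of `𝓛(a,q,M;n)` in degree `i`. -/
def LBoundaries (hac : ∀ i, a i ∈ q ^ c i) : (i : ℕ) → Submodule A (LTerm a M q c n i)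
  | 0 => ⊥
  | i + 1 => LinearMap.range (LD a M n hac i)

lemma LBoundaries_le_ker (hac : ∀ i, a i ∈ q ^ c i) (i : ℕ) :
    LBoundaries a M n hac i ≤ LinearMap.ker (LD a M n hac i) := by
  cases i with
  | zero => exact bot_le
  | succ i => exact LinearMap.range_le_ker_iff.2 (LD_comp_LD a M n hac i)

/-- `Ľ^i(a,q,M;n)`, the `i`-th cohomology of the complex `𝓛(a,q,M;n)`. -/
abbrev LCohomology (hac : ∀ i, a i ∈ q ^ c i) (i : ℕ) : Type u :=
  LinearMap.ker (LD a M n hac i) ⧸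
    (LBoundaries a M n hac i).submoduleOf (LinearMap.ker (LD a M n hac i))

end Cech

end ModCech

end

/-!
Both modules are colimits of one system. Put `p = a_1⋯a_t` and `N_k = (a_1^k,…,a_t^k)M`, and let
`C` be the colimit of `M/N_0 → M/N_1 → ⋯` with multiplication by `p` as transition maps, that is,
the top Čech cohomology of `M`. The predicate `IsPowColimit` characterizes `C` up to isomorphism
(`IsPowColimit.nonempty_linearEquiv`).

*Local cohomology is `C`* (`isPowColimit_localCohomologyModule`). Over a Noetherian ring the
`x`-torsion of an injective module `E` is injective and `E → E_x` is surjective, both by Baer's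
criterion. So for an injective resolution `E` of `M` and `G = Γ_{(a_1,…,a_s)} E` there is an exact
sequence of complexes `0 → Γ_x G → G → G_x → 0`. By induction on `s` the cohomology of `G` vanishes
above degree `s`, and the connecting map identifies the cohomology of `Γ_x G` in degree `s + 1` with
`H^s(G)_x / H^s(G)` (`isPowColimit_of_connecting`, `cohomology_jointTorsion`). Iterated, this gives
the colimit `C` in degree `t` (`IsPowColimit.trans`).

*The modified cohomology is `C` for large `n`* (`isPowColimit_LCohomology`). It is the quotient of
`C` by the image of `qⁿM[q^c/a]`, where `c = c_1 + ⋯ + c_t`, and this image is zero as soon as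
`q^{n+kc}M ⊆ N_k` for all `k`. Condition `(⋆)` says that multiplication by `a_i⋆` on the form
module of `M/(a_1,…,a_{i-1})M` has kernel annihilated by a power of `G_A(q)₊`; hence it is injective
in large degrees, and with the Artin–Rees lemma `qⁿ(M/(a_1,…,a_{i-1})M) ∩ a_i(M/(a_1,…,a_{i-1})M)`
equals `a_i q^{n-c_i}(M/(a_1,…,a_{i-1})M)` for large `n` (`exists_forall_exists_smul_eq`). Starting
from `M/(a_1,…,a_t)M`, which is killed by a power of `q`, this yields `qⁿM ⊆ ∑ a_i q^{n-c_i}M` for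
large `n`, and iterating that inclusion yields the inclusions wanted, with a bound for `n` that does
not depend on `k` (`pow_smul_le_powSubmodule`).
-/

noncomputable section

namespace ModCech

/-! ### Superficial elements from the form module -/

section FormModule

/-- If every associated prime of a finite module containing `s` contains the ideal `I`, then the
submodule annihilated by `s` is annihilated by a power of `I`: its associated primes contain `s`,
hence `I`. -/
theorem exists_pow_smul_eq_zero_of_associatedPrimes {S X : Type*} [CommRing S] [IsNoetherianRing S]
    [AddCommGroup X] [Module S X] [Module.Finite S X] (I : Ideal S) (s : S)
    (h : ∀ P ∈ associatedPrimes S X, ¬ I ≤ P → s ∉ P) :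
    ∃ r : ℕ, ∀ x : X, s • x = 0 → ∀ g ∈ I ^ r, g • x = 0 := by
  let K : Submodule S X := LinearMap.ker (LinearMap.lsmul S X s)
  have hs : s ∈ Module.annihilator S K := by
    rw [Module.mem_annihilator]
    rintro ⟨x, hx⟩
    exact Subtype.ext hx
  have hI : I ≤ (Module.annihilator S K).radical := by
    rw [← Ideal.sInf_minimalPrimes]
    refine le_sInf fun P hP => ?_
    by_contra hIP
    exact h P (associatedPrimes.subset_of_injective K.injective_subtype
      (Module.associatedPrimes.minimalPrimes_annihilator_subset_associatedPrimes S K hP)) hIP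
      (hP.1.2 hs)
  obtain ⟨r, hr⟩ := Ideal.exists_pow_le_of_le_radical_of_fg hI (IsNoetherian.noetherian I)
  exact ⟨r, fun x hx g hg => congrArg Subtype.val (Module.mem_annihilator.1 (hr hg) ⟨x, hx⟩)⟩

lemma initialForm_mem_irrelevantIdeal_pow {A : Type u} [CommRing A] {q : Ideal A} {r : ℕ} {x : A}
    (hx : x ∈ q ^ r) : initialForm hx ∈ irrelevantIdeal q ^ r := by
  induction r generalizing x with
  | zero => simp
  | succ r ih =>
    have h := hx
    rw [pow_succ] at h
    suffices H : ∃ h' : x ∈ q ^ (r + 1), initialForm h' ∈ irrelevantIdeal q ^ (r + 1) from H.2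
    refine Submodule.mul_induction_on (C := fun x => ∃ h' : x ∈ q ^ (r + 1),
      initialForm h' ∈ irrelevantIdeal q ^ (r + 1)) h ?_ ?_
    · intro y hy z hz
      have h' : y * z ∈ q ^ (r + 1) := by
        rw [pow_succ]
        exact Ideal.mul_mem_mul hy hz
      have hz' : z ∈ q ^ 1 := by rwa [pow_one]
      have e : initialForm h' = initialForm hy * initialForm hz' := by
        refine Eq.trans ?_ (map_mul (Ideal.Quotient.mk (shiftIdeal q)) _ _)
        exact congrArg _ (Subtype.ext (Polynomial.monomial_mul_monomial r 1 y z).symm)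
      refine ⟨h', ?_⟩
      rw [e, pow_succ]
      refine Ideal.mul_mem_mul (ih hy) (Ideal.mem_map_of_mem _ ?_)
      change Polynomial.constantCoeff (Polynomial.monomial 1 z) = 0
      simp
    · rintro y z ⟨hy, hy'⟩ ⟨hz, hz'⟩
      refine ⟨add_mem hy hz, ?_⟩
      have e : initialForm (add_mem hy hz) = initialForm hy + initialForm hz :=
        congrArg (Ideal.Quotient.mk (shiftIdeal q))
          (Subtype.ext (map_add (Polynomial.monomial (r + 1)) y z))
      rw [e]
      exact add_mem hy' hz'

variable {A : Type u} [CommRing A] [IsNoetherianRing A] (q : Ideal A)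
  (M : Type u) [AddCommGroup M] [Module A M] [Module.Finite A M]

instance : Module.Finite (FormRing q) (FormModule q M) := by
  have h : (reesModule q M).FG := by
    rw [reesModule, Ideal.Filtration.submodule_fg_iff_stable _ fun _ => IsNoetherian.noetherian _]
    exact Ideal.stableFiltration_stable q ⊤
  have : Module.Finite (reesAlgebra q) (reesModule q M) := Module.Finite.iff_fg.2 h
  let f : reesModule q M →ₛₗ[Ideal.Quotient.mk (shiftIdeal q)] FormModule q M :=
    { toFun := fun g => Submodule.Quotient.mk g
      map_add' := fun _ _ => rfl
      map_smul' := fun _ _ => rfl }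
  exact Module.Finite.of_surjective f (Submodule.Quotient.mk_surjective _)

variable {q M}

/-- If `a⋆` avoids the associated primes of `G_M(q)` outside `V(G_A(q)₊)`, then multiplication by
`a⋆` is injective on `G_M(q)` in large degrees. The kernel is the form module of the filtration
`{m ∈ qⁿM | a m ∈ q^{n+c+1}M}`, which is stable and killed by a power of `q` modulo the next
step of the `q`-adic filtration. -/
theorem exists_forall_mem_of_smul_mem {c : ℕ} {x : A} (hx : x ∈ q ^ c)
    (h : ∀ P ∈ associatedPrimes (FormRing q) (FormModule q M),
      ¬ irrelevantIdeal q ≤ P → initialForm hx ∉ P) :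
    ∃ n₀ : ℕ, ∀ n ≥ n₀, ∀ m ∈ q ^ n • (⊤ : Submodule A M),
      x • m ∈ q ^ (n + c + 1) • (⊤ : Submodule A M) → m ∈ q ^ (n + 1) • (⊤ : Submodule A M) := by
  obtain ⟨r, hr⟩ := exists_pow_smul_eq_zero_of_associatedPrimes _ _ h
  let U : q.Filtration M :=
    { N := fun n => q ^ n • (⊤ : Submodule A M) ⊓
        (q ^ (n + c + 1) • (⊤ : Submodule A M)).comap (LinearMap.lsmul A M x)
      mono := fun i => inf_le_inf (Submodule.smul_mono_left (Ideal.pow_le_pow_right (by omega)))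
        (Submodule.comap_mono (Submodule.smul_mono_left (Ideal.pow_le_pow_right (by omega))))
      smul_le := by
        intro i
        refine Submodule.smul_le.2 fun y hy m hm => ⟨?_, ?_⟩
        · rw [pow_succ', mul_smul]
          exact Submodule.smul_mem_smul hy hm.1
        · change LinearMap.lsmul A M x (y • m) ∈ q ^ (i + 1 + c + 1) • (⊤ : Submodule A M)
          rw [map_smul, add_right_comm i, add_right_comm _ 1 1, pow_succ',
            mul_smul]
          exact Submodule.smul_mem_smul hy hm.2 }
  have hU : U.Stable := (Ideal.stableFiltration_stable q (⊤ : Submodule A M)).of_le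
    fun n => inf_le_left
  obtain ⟨d, hd⟩ := hU.exists_pow_smul_eq
  have key : q ^ r • U.N d ≤ q ^ (d + r + 1) • (⊤ : Submodule A M) := by
    refine Submodule.smul_le.2 fun y hy m hm => ?_
    let g : reesModule q M := ⟨PolynomialModule.single A d m, fun i => by
      rw [PolynomialModule.coeff_single, Finsupp.single_apply]
      split_ifs with hi
      · subst hi
        exact hm.1
      · exact zero_mem _⟩
    let z : FormModule q M := Submodule.Quotient.mk g
    have h2 := hr z (by
        change Submodule.Quotient.mk (_ • g) = _
        rw [Submodule.Quotient.mk_eq_zero]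
        intro n
        change (Polynomial.monomial c x • PolynomialModule.single A d m).coeff n ∈ _
        rw [PolynomialModule.monomial_smul_single, PolynomialModule.coeff_single,
          Finsupp.single_apply]
        split_ifs with hi
        · subst hi
          rw [add_comm c]
          exact hm.2
        · exact zero_mem _)
      _ (initialForm_mem_irrelevantIdeal_pow hy)
    change Submodule.Quotient.mk (_ • g) = _ at h2
    rw [Submodule.Quotient.mk_eq_zero] at h2
    have h3 := h2 (d + r)
    change (Polynomial.monomial r y • PolynomialModule.single A d m).coeff (d + r) ∈ _ at h3
    rwa [PolynomialModule.monomial_smul_single, PolynomialModule.coeff_single,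
      Finsupp.single_apply, if_pos (add_comm r d)] at h3
  refine ⟨d + r, fun n hn m hm hxm => ?_⟩
  obtain ⟨k, rfl⟩ := Nat.exists_eq_add_of_le hn
  have hm' : m ∈ U.N (d + r + k) := ⟨hm, hxm⟩
  rw [add_assoc, hd, add_comm r k, pow_add, mul_smul] at hm'
  have := smul_mono_right (q ^ k) key hm'
  rw [← mul_smul, ← pow_add] at this
  convert this using 3
  omega

/-- Under the hypothesis of `exists_forall_mem_of_smul_mem`, `qⁿM ∩ aM = a q^{n-c}M` for large
`n`: by the Artin–Rees lemma an element of the left side is `a m` with `m` in a large power, and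
then the power can be raised step by step. -/
theorem exists_forall_exists_smul_eq {c : ℕ} {x : A} (hx : x ∈ q ^ c)
    (h : ∀ P ∈ associatedPrimes (FormRing q) (FormModule q M),
      ¬ irrelevantIdeal q ≤ P → initialForm hx ∉ P) :
    ∃ n₀ : ℕ, ∀ n ≥ n₀, ∀ m : M, x • m ∈ q ^ n • (⊤ : Submodule A M) →
      ∃ m' ∈ q ^ (n - c) • (⊤ : Submodule A M), x • m' = x • m := by
  obtain ⟨d, hd⟩ := exists_forall_mem_of_smul_mem hx h
  obtain ⟨r, hr⟩ := q.exists_pow_inf_eq_pow_smul (LinearMap.range (LinearMap.lsmul A M x))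
  refine ⟨d + r, fun n hn m hm => ?_⟩
  have h1 : x • m ∈ q ^ (n - r) • LinearMap.range (LinearMap.lsmul A M x) := by
    have : x • m ∈ q ^ n • ⊤ ⊓ LinearMap.range (LinearMap.lsmul A M x) := ⟨hm, m, rfl⟩
    rw [hr n (by omega)] at this
    exact Submodule.smul_mono le_rfl inf_le_right this
  rw [LinearMap.range_eq_map, ← Submodule.map_smul''] at h1
  obtain ⟨m', hm', e⟩ := h1
  have h2 : ∀ j, m' ∈ q ^ (min (n - r + j) (n - c)) • (⊤ : Submodule A M) := by
    intro j
    induction j with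
    | zero => exact Submodule.smul_mono_left (Ideal.pow_le_pow_right (by omega)) hm'
    | succ j ih =>
      rw [← add_assoc]
      by_cases hj : n - r + j < n - c
      · rw [min_eq_left hj.le] at ih
        rw [min_eq_left (by omega)]
        refine hd _ (by omega) m' ih ?_
        change LinearMap.lsmul A M x m' ∈ _
        rw [e]
        exact Submodule.smul_mono_left (Ideal.pow_le_pow_right (by omega)) hm
      · exact Submodule.smul_mono_left (Ideal.pow_le_pow_right (by omega)) ih
  exact ⟨m', Submodule.smul_mono_left (Ideal.pow_le_pow_right (by omega)) (h2 n), e⟩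

end FormModule

/-! ### Reduction of large powers modulo a system of parameters -/

section Powers

variable {A : Type u} [CommRing A] {M : Type u} [AddCommGroup M] [Module A M]

/-- The submodule `a_1^k M + ⋯ + a_t^k M`. -/
def powSubmodule {t : ℕ} (a : Fin t → A) (M : Type u) [AddCommGroup M] [Module A M] (k : ℕ) :
    Submodule A M :=
  ⨆ j, LinearMap.range (LinearMap.lsmul A M (a j ^ k))

lemma prod_smul_mem_powSubmodule {t : ℕ} (a : Fin t → A) (k : ℕ) {m : M}
    (hm : m ∈ powSubmodule a M k) : (∏ j, a j) • m ∈ powSubmodule a M (k + 1) := by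
  refine (iSup_le fun j => ?_ : powSubmodule a M k ≤
    (powSubmodule a M (k + 1)).comap (LinearMap.lsmul A M (∏ j, a j))) hm
  rintro _ ⟨y, rfl⟩
  refine Submodule.mem_iSup_of_mem j ⟨(∏ i ∈ Finset.univ.erase j, a i) • y, ?_⟩
  simp only [LinearMap.lsmul_apply, smul_smul]
  rw [← Finset.mul_prod_erase _ a (Finset.mem_univ j)]
  congr 1
  ring

lemma exists_pow_smul_eq_bot_of_isFiniteLength [IsLocalRing A] {q : Ideal A} (hq : q ≠ ⊤)
    (h : IsFiniteLength A M) : ∃ n : ℕ, q ^ n • (⊤ : Submodule A M) = ⊥ := by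
  have hM := isFiniteLength_iff_isNoetherian_isArtinian.1 h
  have := hM.1
  have := hM.2
  obtain ⟨n, hn⟩ := IsArtinian.monotone_stabilizes (R := A) (M := M)
    ⟨fun n => OrderDual.toDual (q ^ n • (⊤ : Submodule A M)), fun i j hij =>
      Submodule.smul_mono_left (Ideal.pow_le_pow_right hij)⟩
  refine ⟨n, Submodule.eq_bot_of_le_smul_of_le_jacobson_bot q _ (IsNoetherian.noetherian _) ?_
    ((IsLocalRing.le_maximalIdeal hq).trans (IsLocalRing.maximalIdeal_le_jacobson _))⟩
  have h1 : q ^ n • (⊤ : Submodule A M) = q ^ (n + 1) • (⊤ : Submodule A M) := hn (n + 1) n.le_succ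
  rw [← mul_smul, ← pow_succ']
  exact h1.le

/-- Under condition `(⋆)`, `qⁿM ⊆ ∑ a_j q^{n-c_j}M` for large `n`. The proof descends from
`M/(a_1,…,a_t)M`, where a power of `q` acts as zero, to `M`: an element of `qⁿM` that lies in
`a_i M` modulo the earlier `a_j` can be divided by `a_i` with quotient in `q^{n-c_i}M`. -/
theorem exists_forall_pow_smul_le_iSup [IsNoetherianRing A] [IsLocalRing A] [Module.Finite A M]
    {q : Ideal A} (hq : q ≠ ⊤) {t : ℕ} {a : Fin t → A} {c : Fin t → ℕ} (hac : ∀ i, a i ∈ q ^ c i)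
    (hfin : IsFiniteLength A (M ⧸ (Ideal.span (Set.range a) • (⊤ : Submodule A M))))
    (hstar : ConditionStar M hac) :
    ∃ n₀ : ℕ, ∀ n ≥ n₀, q ^ n • (⊤ : Submodule A M) ≤
      ⨆ j, (q ^ (n - c j) • (⊤ : Submodule A M)).map (LinearMap.lsmul A M (a j)) := by
  let N : ℕ → Submodule A M := fun s => Ideal.span (a '' {j | j.1 < s}) • ⊤
  have hmk : ∀ (P : Submodule A M) (n : ℕ),
      (q ^ n • (⊤ : Submodule A M)).map P.mkQ = q ^ n • (⊤ : Submodule A (M ⧸ P)) := by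
    intro P n
    rw [Submodule.map_smul'', Submodule.map_top, Submodule.range_mkQ]
  suffices H : ∀ k s, s + k = t → ∃ n₀ : ℕ, ∀ n ≥ n₀, q ^ n • (⊤ : Submodule A M) ≤
      (⨆ j, ⨆ _ : s ≤ j.1,
        (q ^ (n - c j) • (⊤ : Submodule A M)).map (LinearMap.lsmul A M (a j))) ⊔ N s by
    obtain ⟨n₀, h⟩ := H t 0 (zero_add t)
    refine ⟨n₀, fun n hn => (h n hn).trans (sup_le (iSup_mono fun j => iSup_le fun _ => le_rfl) ?_)⟩
    simp [N]
  intro k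
  induction k with
  | zero =>
    intro s hs
    obtain rfl : s = t := hs
    obtain ⟨n₀, h⟩ := exists_pow_smul_eq_bot_of_isFiniteLength hq hfin
    refine ⟨n₀, fun n hn => le_sup_of_le_right ?_⟩
    have e : N s = Ideal.span (Set.range a) • (⊤ : Submodule A M) := by
      have : {j : Fin s | j.1 < s} = Set.univ := Set.eq_univ_of_forall fun j => j.2
      simp only [N, this, Set.image_univ]
    rw [e, ← Submodule.ker_mkQ (Ideal.span (Set.range a) • (⊤ : Submodule A M)),
      LinearMap.le_ker_iff_map, hmk, eq_bot_iff, ← h]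
    exact Submodule.smul_mono_left (Ideal.pow_le_pow_right hn)
  | succ k ih =>
    intro s hs
    obtain ⟨n₁, h₁⟩ := ih (s + 1) (by omega)
    let i : Fin t := ⟨s, by omega⟩
    obtain ⟨n₂, h₂⟩ := exists_forall_exists_smul_eq (M := M ⧸ N s) (hac i) (hstar i)
    refine ⟨n₁ + n₂ + ∑ j, c j, fun n hn z hz => ?_⟩
    obtain ⟨u, hu, v, hv, rfl⟩ := Submodule.mem_sup.1 (h₁ n (by omega) hz)
    have hu' : u ∈ q ^ n • (⊤ : Submodule A M) := by
      refine (iSup₂_le fun j _ => ?_ : _ ≤ q ^ n • (⊤ : Submodule A M)) hu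
      rw [Submodule.map_le_iff_le_comap]
      intro w hw
      have hj : c j ≤ n := (Finset.single_le_sum (fun _ _ => Nat.zero_le _)
        (Finset.mem_univ j)).trans (le_trans (Nat.le_add_left _ _) hn)
      rw [← Nat.add_sub_of_le hj, pow_add, mul_smul]
      exact Submodule.smul_mem_smul (hac j) hw
    have hN : N (s + 1) = N s ⊔ LinearMap.range (LinearMap.lsmul A M (a i)) := by
      have e : {j : Fin t | j.1 < s + 1} = insert i {j | j.1 < s} := by
        ext j
        simp only [Set.mem_insert_iff, Set.mem_ofPred_eq, Fin.ext_iff, i]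
        omega
      simp only [N]
      rw [e, Set.image_insert_eq, Ideal.span_insert, Submodule.sup_smul, sup_comm,
        Submodule.ideal_span_singleton_smul, LinearMap.range_eq_map]
      rfl
    rw [hN] at hv
    obtain ⟨v', hv', _, ⟨m, rfl⟩, rfl⟩ := Submodule.mem_sup.1 hv
    rw [LinearMap.lsmul_apply] at hz hv ⊢
    have h3 : a i • (N s).mkQ m ∈ q ^ n • (⊤ : Submodule A (M ⧸ N s)) := by
      rw [← hmk]
      refine ⟨u + (v' + a i • m) - u, sub_mem hz hu', ?_⟩
      rw [← map_smul, ← sub_eq_zero, ← map_sub, Submodule.mkQ_apply, Submodule.Quotient.mk_eq_zero]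
      convert hv' using 1
      abel
    obtain ⟨m', hm', e⟩ := h₂ n (by omega) _ h3
    rw [← hmk] at hm'
    obtain ⟨m'', hm'', rfl⟩ := hm'
    rw [← sub_eq_zero, ← map_smul, ← map_smul, ← map_sub, Submodule.mkQ_apply,
      Submodule.Quotient.mk_eq_zero] at e
    rw [show u + (v' + a i • m) = u + a i • m'' + (v' - (a i • m'' - a i • m)) by abel]
    refine Submodule.add_mem_sup (add_mem ?_ ?_) (sub_mem hv' e)
    · exact (iSup₂_le fun j hj => le_iSup₂_of_le j (by omega) le_rfl : _ ≤ ⨆ j, ⨆ _ : s ≤ j.1,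
        (q ^ (n - c j) • (⊤ : Submodule A M)).map (LinearMap.lsmul A M (a j))) hu
    · exact Submodule.mem_iSup_of_mem i (Submodule.mem_iSup_of_mem le_rfl ⟨m'', hm'', rfl⟩)

/-- If `qⁿM ⊆ ∑ a_j q^{n-c_j}M` for large `n`, then iterating this inclusion until some exponent
reaches `k` gives `q^{n+k(c_1+⋯+c_t)}M ⊆ (a_1^k,…,a_t^k)M`, with a bound for `n` independent
of `k`. -/
theorem pow_smul_le_powSubmodule {q : Ideal A} {t : ℕ} {a : Fin t → A} {c : Fin t → ℕ} {n₀ : ℕ}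
    (h : ∀ n ≥ n₀, q ^ n • (⊤ : Submodule A M) ≤
      ⨆ j, (q ^ (n - c j) • (⊤ : Submodule A M)).map (LinearMap.lsmul A M (a j)))
    {n : ℕ} (hn : n₀ ≤ n) (k : ℕ) :
    q ^ (n + k * ∑ j, c j) • (⊤ : Submodule A M) ≤ powSubmodule a M k := by
  -- induction on the total distance of the exponents `α` of a monomial from `k`
  suffices H : ∀ (e : ℕ) (α : Fin t → ℕ), ∑ j, (k - α j) = e → ∀ l ≥ n₀ + ∑ j, (k - α j) * c j,
      q ^ l • (⊤ : Submodule A M) ≤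
        (powSubmodule a M k).comap (LinearMap.lsmul A M (∏ j, a j ^ α j)) by
    have := H _ 0 rfl (n + k * ∑ j, c j) (by simpa [Finset.mul_sum] using hn)
    intro z hz
    simpa using this hz
  intro e
  induction e using Nat.strong_induction_on with
  | _ e ih =>
    intro α hα l hl
    by_cases hk : ∃ j, k ≤ α j
    · obtain ⟨j, hj⟩ := hk
      intro z _
      obtain ⟨b, hb⟩ : a j ^ k ∣ ∏ j, a j ^ α j :=
        (pow_dvd_pow _ hj).trans (Finset.dvd_prod_of_mem _ (Finset.mem_univ j))
      rw [Submodule.mem_comap, LinearMap.lsmul_apply, hb, mul_smul]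
      exact Submodule.mem_iSup_of_mem j ⟨b • z, rfl⟩
    · push Not at hk
      refine (h l (by omega)).trans (iSup_le fun j => ?_)
      rw [Submodule.map_le_iff_le_comap]
      intro z hz
      let α' : Fin t → ℕ := Function.update α j (α j + 1)
      have h1 : ∀ f : Fin t → ℕ, ∑ i, (k - α i) * f i = ∑ i, (k - α' i) * f i + f j := by
        intro f
        rw [← Finset.add_sum_erase _ _ (Finset.mem_univ j),
          ← Finset.add_sum_erase _ (fun i => (k - α' i) * f i) (Finset.mem_univ j)]
        have h2 : ∑ i ∈ Finset.univ.erase j, (k - α' i) * f i =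
            ∑ i ∈ Finset.univ.erase j, (k - α i) * f i :=
          Finset.sum_congr rfl fun i hi => by
            simp only [α', Function.update_of_ne (Finset.ne_of_mem_erase hi)]
        have h3 : k - α j = k - α' j + 1 := by
          have := hk j
          simp only [α', Function.update_self]
          omega
        rw [h2, h3]
        ring
      have h4 := h1 c
      have h5 := h1 fun _ => 1
      simp only [mul_one] at h5
      have h6 : a j * ∏ i, a i ^ α i = ∏ i, a i ^ α' i := by
        rw [← Finset.mul_prod_erase _ _ (Finset.mem_univ j),
          ← Finset.mul_prod_erase _ (fun i => a i ^ α' i) (Finset.mem_univ j), ← mul_assoc,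
          ← pow_succ']
        congr 1
        · simp [α']
        · exact Finset.prod_congr rfl fun i hi => by
            simp only [α', Function.update_of_ne (Finset.ne_of_mem_erase hi)]
      have := ih _ (by omega) α' rfl (l - c j) (by omega) hz
      rw [Submodule.mem_comap, LinearMap.lsmul_apply, ← h6, mul_comm, mul_smul] at this
      exact this

end Powers

/-! ### Colimits of the quotients `M/N_k` under multiplication by an element -/

section PowColimit

variable {A : Type*} [CommRing A] {M C C' : Type*} [AddCommGroup M] [Module A M]
  [AddCommGroup C] [Module A C] [AddCommGroup C'] [Module A C']

/-- `C` is the colimit of the system `M/N_0 → M/N_1 → M/N_2 → ⋯` with multiplication by `p` as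
transition maps (where `p N_k ⊆ N_{k+1}`), expressed by the maps `φ_k : M → C`. For `p = a_1⋯a_t` and
`N_k = (a_1^k,…,a_t^k)M` this colimit is the top Čech cohomology of `M`, and `φ_k m` is the class
of `m/p^k`. -/
def IsPowColimit (p : A) (N : ℕ → Submodule A M) (C : Type*) [AddCommGroup C] [Module A C] : Prop :=
  ∃ φ : ℕ → M →ₗ[A] C, (∀ k m, φ (k + 1) (p • m) = φ k m) ∧ (∀ z, ∃ k m, φ k m = z) ∧
    ∀ k m, φ k m = 0 ↔ ∃ l, p ^ l • m ∈ N (k + l)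

lemma map_pow_smul_eq {p : A} {φ : ℕ → M →ₗ[A] C} (h : ∀ k m, φ (k + 1) (p • m) = φ k m)
    (k l : ℕ) (m : M) : φ (k + l) (p ^ l • m) = φ k m := by
  induction l with
  | zero => simp
  | succ l ih => rw [pow_succ', mul_smul, ← add_assoc, h, ih]

lemma IsPowColimit.of_linearEquiv {p : A} {N : ℕ → Submodule A M} (h : IsPowColimit p N C)
    (e : C ≃ₗ[A] C') : IsPowColimit p N C' := by
  obtain ⟨φ, h1, h2, h3⟩ := h
  refine ⟨fun k => e.toLinearMap ∘ₗ φ k, fun k m => congrArg e (h1 k m), fun z => ?_, fun k m => ?_⟩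
  · obtain ⟨k, m, hk⟩ := h2 (e.symm z)
    exact ⟨k, m, by simp [hk]⟩
  · simp [h3]

/-- A relation between modules that is a total and single-valued submodule is a linear map. -/
lemma exists_linearMap_of_rel (R : Submodule A (M × C)) (htot : ∀ m, ∃ z, (m, z) ∈ R)
    (huniq : ∀ z, ((0 : M), z) ∈ R → z = 0) : ∃ f : M →ₗ[A] C, ∀ m z, (m, z) ∈ R → f m = z := by
  have hu : ∀ m z z', (m, z) ∈ R → (m, z') ∈ R → z = z' := fun m z z' h h' =>
    sub_eq_zero.1 (huniq _ (by simpa using sub_mem h h'))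
  choose f hf using htot
  exact ⟨{ toFun := f
           map_add' := fun x y => hu _ _ _ (hf _) (add_mem (hf x) (hf y))
           map_smul' := fun r x => hu _ _ _ (hf _) (R.smul_mem r (hf x)) },
    fun m z h => hu _ _ _ (hf m) h⟩

/-- The colimit is unique: `φ_k m ↦ φ'_k m` is a well-defined isomorphism. -/
theorem IsPowColimit.nonempty_linearEquiv {p : A} {N : ℕ → Submodule A M}
    (h : IsPowColimit p N C) (h' : IsPowColimit p N C') : Nonempty (C ≃ₗ[A] C') := by
  obtain ⟨φ, h1, h2, h3⟩ := h
  obtain ⟨φ', h1', h2', h3'⟩ := h'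
  let R : Submodule A (C × C') :=
    { carrier := {z | ∃ k m, φ k m = z.1 ∧ φ' k m = z.2}
      zero_mem' := ⟨0, 0, by simp⟩
      add_mem' := by
        rintro ⟨_, _⟩ ⟨_, _⟩ ⟨k, m, rfl, rfl⟩ ⟨l, n, rfl, rfl⟩
        refine ⟨k + l, p ^ l • m + p ^ k • n, ?_, ?_⟩
        · rw [map_add, map_pow_smul_eq h1, add_comm k, map_pow_smul_eq h1]
          rfl
        · rw [map_add, map_pow_smul_eq h1', add_comm k, map_pow_smul_eq h1']
          rfl
      smul_mem' := by
        rintro r ⟨_, _⟩ ⟨k, m, rfl, rfl⟩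
        exact ⟨k, r • m, map_smul _ _ _, map_smul _ _ _⟩ }
  obtain ⟨f, hf⟩ := exists_linearMap_of_rel R
    (fun z => by
      obtain ⟨k, m, rfl⟩ := h2 z
      exact ⟨_, k, m, rfl, rfl⟩)
    (by
      rintro z ⟨k, m, hk, rfl⟩
      exact (h3' k m).2 ((h3 k m).1 hk))
  have hf' : ∀ k m, f (φ k m) = φ' k m := fun k m => hf _ _ ⟨k, m, rfl, rfl⟩
  refine ⟨LinearEquiv.ofBijective f ⟨(injective_iff_map_eq_zero f).2 fun z hz => ?_, fun z => ?_⟩⟩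
  · obtain ⟨k, m, rfl⟩ := h2 z
    rw [hf'] at hz
    exact (h3 k m).2 ((h3' k m).1 hz)
  · obtain ⟨k, m, rfl⟩ := h2' z
    exact ⟨φ k m, hf' k m⟩

/-- Colimits in two steps: passing to the colimit for `(p, N)` and then for the powers of `x`
amounts to passing to the colimit for `p x` and `N_k + x^k M`. -/
theorem IsPowColimit.trans {p x : A} {N : ℕ → Submodule A M}
    (hN : ∀ k, ∀ m ∈ N k, p • m ∈ N (k + 1)) (h : IsPowColimit p N C)
    (h' : IsPowColimit x (fun k => LinearMap.range (LinearMap.lsmul A C (x ^ k))) C') :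
    IsPowColimit (p * x) (fun k => N k ⊔ LinearMap.range (LinearMap.lsmul A M (x ^ k))) C' := by
  obtain ⟨φ, h1, h2, h3⟩ := h
  obtain ⟨ψ, g1, g2, g3⟩ := h'
  have hN' : ∀ l k, ∀ m ∈ N k, p ^ l • m ∈ N (k + l) := by
    intro l k m hm
    induction l with
    | zero => simpa
    | succ l ih =>
      rw [pow_succ', mul_smul]
      exact hN _ _ ih
  refine ⟨fun k => ψ k ∘ₗ φ k, fun k m => ?_, fun z => ?_, fun k m => ?_⟩
  · rw [LinearMap.comp_apply, LinearMap.comp_apply, mul_comm, mul_smul, map_smul, g1, h1]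
  · obtain ⟨l, z, rfl⟩ := g2 z
    obtain ⟨k, m, rfl⟩ := h2 z
    refine ⟨l + k, x ^ k • p ^ l • m, ?_⟩
    rw [LinearMap.comp_apply, map_smul, map_pow_smul_eq g1, add_comm, map_pow_smul_eq h1]
  · rw [LinearMap.comp_apply, g3]
    constructor
    · rintro ⟨l, z, hz⟩
      obtain ⟨k', m', rfl⟩ := h2 z
      rw [LinearMap.lsmul_apply] at hz
      have h4 : φ (k + k') (p ^ k' • x ^ l • m - p ^ k • x ^ (k + l) • m') = 0 := by
        rw [map_sub, map_pow_smul_eq h1, map_smul, ← hz, add_comm k k', map_pow_smul_eq h1, map_smul,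
          sub_self]
      obtain ⟨e, he⟩ := (h3 _ _).1 h4
      refine ⟨e + k' + l, ?_⟩
      have h5 := (N _).smul_mem (x ^ (e + k')) (hN' l _ _ he)
      have h6 : (p * x) ^ (e + k' + l) • m = x ^ (e + k') • p ^ l • p ^ e •
          (p ^ k' • x ^ l • m - p ^ k • x ^ (k + l) • m') +
          x ^ (k + (e + k' + l)) • p ^ (k + l + e) • m' := by
        simp only [smul_sub, smul_smul]
        rw [show x ^ (e + k') * (p ^ l * (p ^ e * (p ^ k * x ^ (k + l)))) =
          x ^ (k + (e + k' + l)) * p ^ (k + l + e) by ring, sub_add_cancel]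
        congr 1
        ring
      rw [h6]
      refine Submodule.add_mem_sup ?_ ⟨_, rfl⟩
      convert h5 using 2
      omega
    · rintro ⟨l, hl⟩
      obtain ⟨u, hu, _, ⟨m', rfl⟩, e⟩ := Submodule.mem_sup.1 hl
      rw [LinearMap.lsmul_apply] at e
      refine ⟨l, φ (k + l) m', ?_⟩
      have h4 : φ (k + l) u = 0 := (h3 _ _).2 ⟨0, by simpa using hu⟩
      have h5 := congrArg (φ (k + l)) e
      rw [map_add, h4, zero_add, mul_pow, mul_comm, mul_smul, map_smul, map_smul,
        map_pow_smul_eq h1] at h5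
      exact h5

end PowColimit

/-! ### Torsion in injective modules over Noetherian rings -/

section Torsion

variable {A : Type u} [CommRing A] {E : Type u} [AddCommGroup E] [Module A E]

/-- The submodule of the elements killed by a power of `x`. -/
def powTorsion (x : A) (E : Type u) [AddCommGroup E] [Module A E] : Submodule A E where
  carrier := {e | ∃ k : ℕ, x ^ k • e = 0}
  zero_mem' := ⟨0, smul_zero _⟩
  add_mem' := by
    rintro y z ⟨k, hk⟩ ⟨l, hl⟩
    exact ⟨k + l, by rw [smul_add, pow_add, mul_comm, mul_smul, hk, mul_comm, mul_smul, hl]; simp⟩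
  smul_mem' := by
    rintro r y ⟨k, hk⟩
    exact ⟨k, by rw [smul_comm, hk, smul_zero]⟩

/-- The submodule of the elements killed by powers of all the `a_j`. -/
def jointTorsion {s : ℕ} (a : Fin s → A) (E : Type u) [AddCommGroup E] [Module A E] :
    Submodule A E :=
  ⨅ j, powTorsion (a j) E

lemma map_mem_jointTorsion {F : Type u} [AddCommGroup F] [Module A F] {s : ℕ} (a : Fin s → A)
    (f : E →ₗ[A] F) {e : E} (he : e ∈ jointTorsion a E) : f e ∈ jointTorsion a F := by
  rw [jointTorsion, Submodule.mem_iInf] at he ⊢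
  intro j
  obtain ⟨k, hk⟩ := he j
  exact ⟨k, by rw [← map_smul, hk, map_zero]⟩

lemma jointTorsion_succ {s : ℕ} (a : Fin (s + 1) → A) :
    jointTorsion a E = jointTorsion (fun j => a (Fin.castSucc j)) E ⊓ powTorsion (a (Fin.last s)) E := by
  ext e
  simp only [jointTorsion, Submodule.mem_inf, Submodule.mem_iInf, Fin.forall_fin_succ']

/-- Baer's extension property for a submodule `G` of `E`: every linear map from an ideal with
values in `G` is multiplication by an element of `G`. -/
def IsBaerIn (G : Submodule A E) : Prop :=
  ∀ (J : Ideal A) (f : J →ₗ[A] E), (∀ y, f y ∈ G) → ∃ e ∈ G, ∀ y : J, f y = y.1 • e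

variable [IsNoetherianRing A]

/-- Over a Noetherian ring, `G → G_x` is surjective if `G` is injective. -/
lemma IsBaerIn.exists_pow_smul_eq {G : Submodule A E} (hG : IsBaerIn G) (x : A) {g : E} (hg : g ∈ G)
    (k : ℕ) : ∃ g' ∈ G, ∃ m : ℕ, x ^ (m + k) • g' = x ^ m • g := by
  -- the annihilators of the powers of `x` stabilize
  obtain ⟨m, hm⟩ := monotone_stabilizes_iff_noetherian.2 ‹IsNoetherianRing A›
    ⟨fun n => LinearMap.ker (LinearMap.lsmul A A (x ^ n)), fun i j hij y hy => by
      obtain ⟨l, rfl⟩ := Nat.exists_eq_add_of_le hij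
      change x ^ (i + l) * y = 0
      rw [pow_add, mul_right_comm, show x ^ i * y = 0 from hy, zero_mul]⟩
  let J : Ideal A := Ideal.span {x ^ (m + k)}
  let R : Submodule A (J × E) :=
    { carrier := {z | ∃ b : A, z.1.1 = b * x ^ (m + k) ∧ z.2 = b • x ^ m • g}
      zero_mem' := ⟨0, by simp⟩
      add_mem' := by
        rintro _ _ ⟨b, h1, h2⟩ ⟨b', h1', h2'⟩
        exact ⟨b + b', by simp [h1, h1', add_mul], by simp [h2, h2', add_smul]⟩
      smul_mem' := by
        rintro r _ ⟨b, h1, h2⟩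
        exact ⟨r * b, by simp [h1, mul_assoc], by simp [h2, mul_smul]⟩ }
  obtain ⟨f, hf⟩ := exists_linearMap_of_rel R
    (by
      rintro ⟨y, hy⟩
      obtain ⟨b, rfl⟩ := Ideal.mem_span_singleton'.1 hy
      exact ⟨_, b, rfl, rfl⟩)
    (by
      rintro z ⟨b, h1, h2⟩
      have : b ∈ LinearMap.ker (LinearMap.lsmul A A (x ^ (m + k))) := by
        change x ^ (m + k) * b = 0
        rw [mul_comm]
        exact h1.symm
      have h3 : b ∈ LinearMap.ker (LinearMap.lsmul A A (x ^ m)) := by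
        have := hm (m + k) (Nat.le_add_right _ _)
        exact this.ge ‹_›
      change x ^ m * b = 0 at h3
      rw [smul_smul, mul_comm, h3, zero_smul] at h2
      exact h2)
  obtain ⟨e, he, h⟩ := hG J f (by
    rintro ⟨y, hy⟩
    obtain ⟨b, rfl⟩ := Ideal.mem_span_singleton'.1 hy
    rw [hf ⟨_, hy⟩ (b • x ^ m • g) ⟨b, rfl, rfl⟩]
    exact G.smul_mem _ (G.smul_mem _ hg))
  refine ⟨e, he, m, ?_⟩
  have hx : x ^ (m + k) ∈ J := Ideal.mem_span_singleton_self _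
  rw [← h ⟨_, hx⟩]
  exact hf ⟨_, hx⟩ _ ⟨1, by simp, by simp⟩

/-- Over a Noetherian ring, the `x`-torsion of an injective module is injective: a map `f` from an
ideal `J` to the torsion is killed by some `x^k`, so by the Artin–Rees lemma it vanishes on
`J ∩ x^n A`, and it extends to `J + x^n A` by zero on `x^n`. -/
lemma IsBaerIn.inf_powTorsion {G : Submodule A E} (hG : IsBaerIn G) (x : A) :
    IsBaerIn (G ⊓ powTorsion x E) := by
  intro J f hf
  obtain ⟨k, hk⟩ : ∃ k : ℕ, ∀ y, x ^ k • f y = 0 := by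
    obtain ⟨k, hk⟩ := monotone_stabilizes_iff_noetherian.2 (inferInstance : IsNoetherian A J)
      ⟨fun n => LinearMap.ker (x ^ n • f), fun i j hij y hy => by
        obtain ⟨l, rfl⟩ := Nat.exists_eq_add_of_le hij
        change x ^ (i + l) • f y = 0
        rw [pow_add, mul_comm, mul_smul, show x ^ i • f y = 0 from hy, smul_zero]⟩
    refine ⟨k, fun y => ?_⟩
    obtain ⟨l, hl⟩ := (hf y).2
    have h1 : y ∈ LinearMap.ker (x ^ (k + l) • f) := by
      change x ^ (k + l) • f y = 0
      rw [pow_add, mul_smul, hl, smul_zero]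
    exact (hk (k + l) (Nat.le_add_right _ _)).ge h1
  obtain ⟨n, hn⟩ : ∃ n : ℕ, ∀ b : A, ∀ h : b * x ^ n ∈ J, f ⟨_, h⟩ = 0 := by
    obtain ⟨r, hr⟩ := (Ideal.span {x}).exists_pow_inf_eq_pow_smul J
    refine ⟨r + k, fun b h => ?_⟩
    have h1 : b * x ^ (r + k) ∈ Ideal.span {x} ^ (r + k) • (⊤ : Ideal A) ⊓ J := by
      refine ⟨?_, h⟩
      rw [Ideal.span_singleton_pow, smul_eq_mul, Ideal.mul_top]
      exact Ideal.mem_span_singleton'.2 ⟨b, rfl⟩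
    rw [hr _ (Nat.le_add_right _ _), Nat.add_sub_cancel_left, Ideal.span_singleton_pow,
      Submodule.ideal_span_singleton_smul] at h1
    obtain ⟨y, hy, e⟩ := h1
    have h2 : (⟨_, h⟩ : J) = x ^ k • ⟨y, hy.2⟩ := Subtype.ext e.symm
    rw [h2, map_smul, hk]
  let J' : Ideal A := J ⊔ Ideal.span {x ^ n}
  let R : Submodule A (J' × E) :=
    { carrier := {z | ∃ y : J, ∃ b : A, z.1.1 = y.1 + b * x ^ n ∧ z.2 = f y}
      zero_mem' := ⟨0, 0, by simp⟩
      add_mem' := by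
        rintro _ _ ⟨y, b, h1, h2⟩ ⟨y', b', h1', h2'⟩
        exact ⟨y + y', b + b', by simp [h1, h1']; ring, by simp [h2, h2']⟩
      smul_mem' := by
        rintro r _ ⟨y, b, h1, h2⟩
        exact ⟨r • y, r * b, by simp [h1]; ring, by simp [h2]⟩ }
  have htot : ∀ z : J', ∃ e, (z, e) ∈ R := by
    rintro ⟨z, hz⟩
    obtain ⟨y, hy, w, hw, rfl⟩ := Submodule.mem_sup.1 hz
    obtain ⟨b, rfl⟩ := Ideal.mem_span_singleton'.1 hw
    exact ⟨f ⟨y, hy⟩, ⟨y, hy⟩, b, rfl, rfl⟩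
  obtain ⟨f', hf'⟩ := exists_linearMap_of_rel R htot (by
    rintro z ⟨⟨y, hy⟩, b, h1, h2⟩
    have h3 : y = -b * x ^ n := by
      have : (0 : A) = y + b * x ^ n := h1
      linear_combination -this
    subst h3
    exact h2.trans (hn _ hy))
  obtain ⟨e, he, h⟩ := hG J' f' (by
    intro z
    obtain ⟨w, hw⟩ := htot z
    rw [hf' _ _ hw]
    obtain ⟨y, b, -, h2⟩ := hw
    change w = f y at h2
    rw [h2]
    exact (hf y).1)
  refine ⟨e, ⟨he, n, ?_⟩, fun y => ?_⟩
  · have hx : x ^ n ∈ J' := Ideal.mem_sup_right (Ideal.mem_span_singleton_self _)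
    rw [← h ⟨_, hx⟩]
    exact hf' ⟨_, hx⟩ _ ⟨0, 1, by simp, by simp⟩
  · have hy : y.1 ∈ J' := Ideal.mem_sup_left y.2
    rw [← h ⟨_, hy⟩]
    exact (hf' ⟨_, hy⟩ _ ⟨y, 0, by simp, rfl⟩).symm

lemma isBaerIn_jointTorsion (hE : IsBaerIn (⊤ : Submodule A E)) {s : ℕ} (a : Fin s → A) :
    IsBaerIn (jointTorsion a E) := by
  induction s with
  | zero => rwa [jointTorsion, iInf_of_empty]
  | succ s ih =>
    rw [jointTorsion_succ]
    exact (ih _).inf_powTorsion _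

end Torsion

/-! ### Cohomology of the torsion of an injective complex -/

section TorsionCohomology

variable {A : Type u} [CommRing A]

/-- Let `d : G → F` be part of a complex and let every `x`-torsion cocycle of `F` be a coboundary.
If `G → G_x` is surjective, then the connecting map `H(G)_x / H(G) → H'` to the cohomology of the
`x`-torsion one degree higher is an isomorphism: it sends the class of `ζ/x^k` to the class of
`d g`, where `g` represents the fraction `ζ/x^k` of `G_x`. The submodule `B` consists of the
coboundaries of `G`. -/
theorem isPowColimit_of_connecting {E F : Type u} [AddCommGroup E] [Module A E] [AddCommGroup F]
    [Module A F] (x : A) (d : E →ₗ[A] F) (G B Z : Submodule A E) (Z' : Submodule A F)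
    (hZ : Z = G ⊓ LinearMap.ker d)
    (hG : ∀ g ∈ G, ∀ k : ℕ, ∃ g' ∈ G, ∃ m : ℕ, x ^ (m + k) • g' = x ^ m • g)
    (hBZ : B ≤ Z) (hB : ∀ b ∈ B, ∀ k : ℕ, ∃ b' ∈ B, ∃ m : ℕ, x ^ (m + k) • b' = x ^ m • b)
    (hZ' : ∀ z, z ∈ Z' ↔ (∃ g ∈ G, d g = z) ∧ z ∈ powTorsion x F) :
    IsPowColimit x
      (fun k => LinearMap.range (LinearMap.lsmul A (Z ⧸ B.submoduleOf Z) (x ^ k)))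
      (Z' ⧸ ((G ⊓ powTorsion x E).map d).submoduleOf Z') := by
  subst hZ
  set Z := G ⊓ LinearMap.ker d with hZ
  let C' := Z' ⧸ ((G ⊓ powTorsion x E).map d).submoduleOf Z'
  have hdZ : ∀ ζ ∈ Z, d ζ = 0 := fun ζ h => h.2
  -- the graph of `ζ ↦ [d g]`, where `g` represents `ζ/x^k`
  let R : ℕ → Submodule A (Z × C') := fun k =>
    { carrier := {w | ∃ g ∈ G, ∃ z : Z', d g = z.1 ∧ Submodule.Quotient.mk z = w.2 ∧
        ∃ m : ℕ, x ^ (m + k) • g = x ^ m • w.1.1}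
      zero_mem' := ⟨0, zero_mem _, 0, by simp⟩
      add_mem' := by
        rintro ⟨w, _⟩ ⟨w', _⟩ ⟨g, hg, z, h, rfl, m, e⟩ ⟨g', hg', z', h', rfl, m', e'⟩
        refine ⟨g + g', add_mem hg hg', z + z', by simp [h, h'], rfl, m + m', ?_⟩
        change _ = x ^ (m + m') • (w.1 + w'.1)
        have h1 : x ^ (m + m' + k) • g = x ^ (m + m') • w.1 := by
          rw [show m + m' + k = m' + (m + k) by omega, pow_add, mul_smul, e, smul_smul, ← pow_add,
            add_comm m']
        have h2 : x ^ (m + m' + k) • g' = x ^ (m + m') • w'.1 := by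
          rw [add_assoc, pow_add, mul_smul, e', smul_smul, ← pow_add]
        rw [smul_add, smul_add, h1, h2]
      smul_mem' := by
        rintro r ⟨w, _⟩ ⟨g, hg, z, h, rfl, m, e⟩
        refine ⟨r • g, G.smul_mem _ hg, r • z, by simp [h], rfl, m, ?_⟩
        change _ = x ^ m • r • w.1
        rw [smul_comm, e, smul_comm] }
  have hex : ∀ k (ζ : Z), ∃ g ∈ G, ∃ z : Z', d g = z.1 ∧ ∃ m : ℕ, x ^ (m + k) • g = x ^ m • ζ.1 := by
    intro k ζ
    obtain ⟨g, hg, m, e⟩ := hG ζ.1 ζ.2.1 k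
    refine ⟨g, hg, ⟨d g, (hZ' _).2 ⟨⟨g, hg, rfl⟩, m + k, ?_⟩⟩, rfl, m, e⟩
    rw [← map_smul, e, map_smul, hdZ _ ζ.2, smul_zero]
  have hfun : ∀ k, ∃ f : Z →ₗ[A] C', ∀ ζ w, (ζ, w) ∈ R k → f ζ = w := by
    intro k
    refine exists_linearMap_of_rel (R k) (fun ζ => ?_) ?_
    · obtain ⟨g, hg, z, h, m, e⟩ := hex k ζ
      exact ⟨_, g, hg, z, h, rfl, m, e⟩
    · rintro _ ⟨g, hg, z, h, rfl, m, e⟩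
      exact (Submodule.Quotient.mk_eq_zero _).2 ⟨g, ⟨hg, m + k, by simpa using e⟩, h⟩
  choose f hf using hfun
  have hfB : ∀ k, B.submoduleOf Z ≤ LinearMap.ker (f k) := by
    intro k ζ hζ
    obtain ⟨b, hb, m, e⟩ := hB ζ.1 hζ k
    exact hf k ζ 0 ⟨b, (hBZ hb).1, 0, by simpa using hdZ b (hBZ hb), rfl, m, e⟩
  let ψ : ℕ → (Z ⧸ B.submoduleOf Z) →ₗ[A] C' := fun k => (B.submoduleOf Z).liftQ (f k) (hfB k)
  have hψ : ∀ k (ζ : Z) g (z : Z') (m : ℕ), g ∈ G → d g = z.1 → x ^ (m + k) • g = x ^ m • ζ.1 →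
      ψ k (Submodule.Quotient.mk ζ) = Submodule.Quotient.mk z := fun k ζ g z m hg h e =>
    hf k ζ _ ⟨g, hg, z, h, rfl, m, e⟩
  have h1 : ∀ k c, ψ (k + 1) (x • c) = ψ k c := by
    intro k c
    obtain ⟨ζ, rfl⟩ := Submodule.Quotient.mk_surjective _ c
    obtain ⟨g, hg, z, h, m, e⟩ := hex k ζ
    rw [hψ k ζ g z m hg h e, ← Submodule.Quotient.mk_smul]
    refine hψ (k + 1) (x • ζ) g z m hg h ?_
    change _ = x ^ m • x • ζ.1
    rw [← add_assoc, pow_succ', mul_smul, e, smul_comm]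
  refine ⟨ψ, h1, fun w => ?_, fun k c => ?_⟩
  · obtain ⟨⟨z, hz⟩, rfl⟩ := Submodule.Quotient.mk_surjective _ w
    obtain ⟨⟨g, hg, rfl⟩, k, hk⟩ := (hZ' z).1 hz
    have hζ : x ^ k • g ∈ Z := ⟨G.smul_mem _ hg, (map_smul d _ _).trans hk⟩
    exact ⟨k, Submodule.Quotient.mk ⟨_, hζ⟩, hψ k ⟨_, hζ⟩ g ⟨_, hz⟩ 0 hg rfl (by simp)⟩
  · obtain ⟨ζ, rfl⟩ := Submodule.Quotient.mk_surjective _ c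
    constructor
    · -- if `d g = d y` with `y` torsion, then the cocycle `g - y` also represents `ζ/x^k`
      intro h0
      obtain ⟨g, hg, z, h, m, e⟩ := hex k ζ
      rw [hψ k ζ g z m hg h e, Submodule.Quotient.mk_eq_zero] at h0
      obtain ⟨y, ⟨hy, p, hp⟩, e'⟩ := h0
      have hy' : g - y ∈ Z := ⟨sub_mem hg hy, by
        change d (g - y) = 0
        rw [map_sub, h, e']
        exact sub_self _⟩
      refine ⟨m + p, Submodule.Quotient.mk ⟨_, hy'⟩, ?_⟩
      rw [LinearMap.lsmul_apply, ← Submodule.Quotient.mk_smul, ← Submodule.Quotient.mk_smul]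
      refine congrArg _ (Subtype.ext ?_)
      change x ^ (k + (m + p)) • (g - y) = x ^ (m + p) • ζ.1
      rw [show k + (m + p) = (m + k) + p by omega, smul_sub, pow_add x (m + k) p, mul_smul _ _ y, hp,
        smul_zero, sub_zero, mul_comm, mul_smul, e, smul_smul, ← pow_add, add_comm]
    · rintro ⟨l, c, hc⟩
      obtain ⟨ξ, rfl⟩ := Submodule.Quotient.mk_surjective _ c
      rw [← map_pow_smul_eq h1 k l, ← hc, LinearMap.lsmul_apply]
      have := map_pow_smul_eq h1 0 (k + l) (Submodule.Quotient.mk ξ)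
      rw [zero_add] at this
      rw [this]
      exact hψ 0 ξ ξ.1 0 0 ξ.2.1 (hdZ _ ξ.2) (by simp)

variable {E : ℕ → Type u} [∀ i, AddCommGroup (E i)] [∀ i, Module A (E i)]
  (d : ∀ i, E i →ₗ[A] E (i + 1)) (G : ∀ i, Submodule A (E i))

/-- The cocycles of the subcomplex `G` of `(E, d)`. -/
abbrev subCocycles (i : ℕ) : Submodule A (E i) := G i ⊓ LinearMap.ker (d i)

/-- The coboundaries of the subcomplex `G` of `(E, d)`. -/
def subCoboundaries : (i : ℕ) → Submodule A (E i)
  | 0 => ⊥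
  | i + 1 => (G i).map (d i)

/-- The cohomology of the subcomplex `G` of `(E, d)`. -/
abbrev SubCohomology (i : ℕ) : Type u :=
  subCocycles d G i ⧸ (subCoboundaries d G i).submoduleOf (subCocycles d G i)

variable {d}

lemma subCoboundaries_le_subCocycles (hd : ∀ i z, d (i + 1) (d i z) = 0)
    (hG : ∀ i, ∀ z ∈ G i, d i z ∈ G (i + 1)) (i : ℕ) :
    subCoboundaries d G i ≤ subCocycles d G i := by
  cases i with
  | zero => exact bot_le
  | succ i =>
    rintro _ ⟨z, hz, rfl⟩
    exact ⟨hG i z hz, hd i z⟩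

/-- If `E` is an injective resolution of `M` over a Noetherian ring, then the torsion of `E` with
respect to `a_1,…,a_s` has no cohomology above degree `s`, and in degree `s` its cohomology is the
top Čech cohomology of `M`. Adding one element `x` to the sequence relates the two torsion
subcomplexes `G` and `K = Γ_x G` by the exact sequence `0 → K → G → G_x → 0`. -/
theorem cohomology_jointTorsion [IsNoetherianRing A] {M : Type u} [AddCommGroup M] [Module A M]
    (hd : ∀ i z, d (i + 1) (d i z) = 0) (hexact : ∀ i z, d (i + 1) z = 0 → ∃ y, d i y = z)
    (hE : ∀ i, IsBaerIn (⊤ : Submodule A (E i))) (ε : M →ₗ[A] E 0) (hε : Function.Injective ε)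
    (hε' : ∀ z, d 0 z = 0 ↔ ∃ m, ε m = z) {s : ℕ} (a : Fin s → A) :
    (∀ i, s ≤ i → ∀ z ∈ jointTorsion a (E (i + 1)), d (i + 1) z = 0 →
      ∃ y ∈ jointTorsion a (E i), d i y = z) ∧
    IsPowColimit (∏ j, a j) (powSubmodule a M)
      (SubCohomology d (fun i => jointTorsion a (E i)) s) := by
  induction s with
  | zero =>
    have htop : ∀ i, jointTorsion a (E i) = ⊤ := fun i => iInf_of_empty _
    refine ⟨fun i _ z _ hz => ?_, ?_⟩
    · obtain ⟨y, hy⟩ := hexact i z hz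
      exact ⟨y, by rw [htop]; trivial, hy⟩
    · have h0 : IsPowColimit (∏ j, a j) (powSubmodule a M) M := by
        refine ⟨fun _ => LinearMap.id, fun k m => by simp, fun z => ⟨0, z, rfl⟩, fun k m => ?_⟩
        have : powSubmodule a M = fun _ => ⊥ := funext fun _ => iSup_of_empty _
        simp [this]
      let f : M →ₗ[A] subCocycles d (fun i => jointTorsion a (E i)) 0 :=
        ε.codRestrict _ fun m => ⟨(htop 0).ge trivial, (hε' _).2 ⟨m, rfl⟩⟩
      refine h0.of_linearEquiv (LinearEquiv.ofBijective (Submodule.mkQ _ ∘ₗ f) ⟨?_, ?_⟩)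
      · rw [injective_iff_map_eq_zero]
        intro m hm
        have hm' : ε m = 0 := (Submodule.Quotient.mk_eq_zero _).1 hm
        exact hε (by rw [hm', map_zero])
      · intro z
        obtain ⟨⟨z, hz⟩, rfl⟩ := Submodule.Quotient.mk_surjective _ z
        obtain ⟨m, rfl⟩ := (hε' z).1 hz.2
        exact ⟨m, rfl⟩
  | succ s ih =>
    let b : Fin s → A := fun j => a (Fin.castSucc j)
    let x : A := a (Fin.last s)
    obtain ⟨ih1, ih2⟩ := ih b
    have hdiv : ∀ i, ∀ g ∈ jointTorsion b (E i), ∀ k : ℕ, ∃ g' ∈ jointTorsion b (E i), ∃ m : ℕ,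
        x ^ (m + k) • g' = x ^ m • g := fun i g hg k =>
      (isBaerIn_jointTorsion (hE i) b).exists_pow_smul_eq x hg k
    refine ⟨fun i hi z hz hdz => ?_, ?_⟩
    · -- if `z = d g` and `x^k g = d h`, then `g` differs from `d (h/x^k)` by torsion
      obtain ⟨i, rfl⟩ := Nat.exists_eq_add_of_le' (show 1 ≤ i by omega)
      rw [jointTorsion_succ] at hz ⊢
      obtain ⟨hz1, k, hk⟩ := hz
      obtain ⟨g, hg, rfl⟩ := ih1 (i + 1) (by omega) z hz1 hdz
      obtain ⟨h, hh, e⟩ := ih1 i (by omega) (x ^ k • g) (Submodule.smul_mem _ _ hg)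
        (by rw [map_smul]; exact hk)
      obtain ⟨h', hh', m, e'⟩ := hdiv i h hh k
      refine ⟨g - d i h', ⟨sub_mem hg (map_mem_jointTorsion b _ hh'), m + k, ?_⟩, ?_⟩
      · change x ^ (m + k) • (g - d i h') = 0
        rw [smul_sub, ← map_smul, e', map_smul, e, smul_smul, ← pow_add, sub_self]
      · rw [map_sub, hd, sub_zero]
    · have hfam : (fun i => jointTorsion a (E i)) =
          fun i => jointTorsion b (E i) ⊓ powTorsion x (E i) := funext fun i => jointTorsion_succ a
      have hp : ∏ j, a j = (∏ j, b j) * x := Fin.prod_univ_castSucc a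
      have hN : powSubmodule a M =
          fun k => powSubmodule b M k ⊔ LinearMap.range (LinearMap.lsmul A M (x ^ k)) := by
        funext k
        apply le_antisymm
        · refine iSup_le fun j => ?_
          induction j using Fin.lastCases with
          | last => exact le_sup_right
          | cast j => exact le_sup_of_le_left (le_iSup
              (fun j => LinearMap.range (LinearMap.lsmul A M (b j ^ k))) j)
        · exact sup_le (iSup_le fun j => le_iSup
            (fun j => LinearMap.range (LinearMap.lsmul A M (a j ^ k))) (Fin.castSucc j))
            (le_iSup (fun j => LinearMap.range (LinearMap.lsmul A M (a j ^ k))) (Fin.last s))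
      rw [hfam, hp, hN]
      refine ih2.trans (fun k m hm => prod_smul_mem_powSubmodule b k hm) ?_
      refine isPowColimit_of_connecting x (d s) (jointTorsion b (E s)) _ _ _ rfl (hdiv s)
        (subCoboundaries_le_subCocycles _ hd (fun i z hz => map_mem_jointTorsion b _ hz) s) ?_ ?_
      · -- the coboundaries inherit the divisibility by `x`
        cases s with
        | zero =>
          intro y hy k
          exact ⟨0, zero_mem _, 0, by rw [(Submodule.mem_bot A).1 hy]; simp⟩
        | succ s =>
          rintro _ ⟨y, hy, rfl⟩ k
          obtain ⟨y', hy', m, e⟩ := hdiv s y hy k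
          exact ⟨_, ⟨y', hy', rfl⟩, m, by rw [← map_smul, e, map_smul]⟩
      · intro z
        constructor
        · rintro ⟨⟨hz, hz'⟩, hdz⟩
          exact ⟨ih1 s le_rfl z hz hdz, hz'⟩
        · rintro ⟨⟨g, hg, rfl⟩, hz⟩
          exact ⟨⟨map_mem_jointTorsion b _ hg, hz⟩, hd s g⟩

end TorsionCohomology

/-! ### Local cohomology in the top degree -/

section LocalCohomology

variable {A : Type u} [CommRing A]

lemma gammaSubmodule_span_range {s : ℕ} (a : Fin s → A) (E : Type u) [AddCommGroup E] [Module A E] :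
    gammaSubmodule (Ideal.span (Set.range a)) E = jointTorsion a E := by
  ext e
  have h : e ∈ gammaSubmodule (Ideal.span (Set.range a)) E ↔
      Ideal.span (Set.range a) ≤ (Module.annihilator A (Submodule.span A {e})).radical := by
    change Module.support A (Submodule.span A {e}) ⊆ PrimeSpectrum.zeroLocus _ ↔ _
    rw [Module.support_eq_zeroLocus, PrimeSpectrum.zeroLocus_subset_zeroLocus_iff]
  rw [h, Ideal.span_le, Set.range_subset_iff, jointTorsion, Submodule.mem_iInf]
  refine forall_congr' fun j => ?_
  rw [SetLike.mem_coe, Ideal.mem_radical_iff]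
  refine exists_congr fun k => ?_
  rw [Submodule.mem_annihilator_span_singleton]

/-- The homology of a short complex of modules whose middle term is embedded in a module `E`, as a
subquotient of `E`. -/
lemma nonempty_shortComplex_homology_linearEquiv (S : ShortComplex (ModuleCat.{u} A)) {E : Type u}
    [AddCommGroup E] [Module A E] (j : S.X₂ →ₗ[A] E) (hj : Function.Injective j)
    (Z B : Submodule A E) (hZ : ∀ e, e ∈ Z ↔ ∃ y, S.g y = 0 ∧ j y = e)
    (hB : ∀ e, e ∈ B ↔ ∃ y, j (S.f y) = e) :
    Nonempty (S.homology ≃ₗ[A] Z ⧸ B.submoduleOf Z) := by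
  let f : LinearMap.ker S.g.hom →ₗ[A] Z :=
    (j ∘ₗ (LinearMap.ker S.g.hom).subtype).codRestrict Z fun y => (hZ _).2 ⟨y.1, y.2, rfl⟩
  have hf : Function.Bijective f := by
    refine ⟨fun y y' h => Subtype.ext (hj (congrArg Subtype.val h)), ?_⟩
    rintro ⟨z, hz⟩
    obtain ⟨y, hy, rfl⟩ := (hZ z).1 hz
    exact ⟨⟨y, hy⟩, rfl⟩
  refine ⟨S.moduleCatHomologyIso.toLinearEquiv.trans
    (Submodule.Quotient.equiv (LinearMap.range S.moduleCatToCycles) (B.submoduleOf Z)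
      (LinearEquiv.ofBijective f hf) ?_)⟩
  ext ⟨z, hz⟩
  constructor
  · rintro ⟨_, ⟨y, rfl⟩, h⟩
    exact (hB z).2 ⟨y, congrArg Subtype.val h⟩
  · intro h
    obtain ⟨y, hy⟩ := (hB z).1 h
    exact ⟨_, ⟨y, rfl⟩, Subtype.ext hy⟩

/-- The homology of a complex of modules obtained by applying `Γ_I` to a complex `K`, as the
cohomology of the subcomplex of torsion elements. -/
lemma nonempty_homology_gammaFunctor_linearEquiv (I : Ideal A) (K : CochainComplex (ModuleCat.{u} A) ℕ)
    (n : ℕ) : Nonempty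
      ((((gammaFunctor I).mapHomologicalComplex _).obj K).homology n ≃ₗ[A]
        SubCohomology (E := fun i => K.X i) (fun i => (K.d i (i + 1)).hom)
          (fun i => gammaSubmodule I (K.X i)) n) := by
  let L := ((gammaFunctor I).mapHomologicalComplex (ComplexShape.up ℕ)).obj K
  have key : ∀ i, (ComplexShape.up ℕ).prev n = i →
      (∀ e, e ∈ subCoboundaries (E := fun i => K.X i) (fun i => (K.d i (i + 1)).hom)
          (fun i => gammaSubmodule I (K.X i)) n ↔
        ∃ y : gammaSubmodule I (K.X i), (K.d i n).hom y.1 = e) →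
      Nonempty (L.homology n ≃ₗ[A] SubCohomology (E := fun i => K.X i)
        (fun i => (K.d i (i + 1)).hom) (fun i => gammaSubmodule I (K.X i)) n) := by
    intro i hi h
    obtain ⟨e⟩ := nonempty_shortComplex_homology_linearEquiv (L.sc' i n (n + 1))
      (gammaSubmodule I (K.X n)).subtype (Submodule.injective_subtype _)
      (subCocycles (E := fun i => K.X i) (fun i => (K.d i (i + 1)).hom)
        (fun i => gammaSubmodule I (K.X i)) n) _
      (fun e => by
        constructor
        · rintro ⟨h1, h2⟩
          exact ⟨⟨e, h1⟩, Subtype.ext h2, rfl⟩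
        · rintro ⟨y, hy, rfl⟩
          exact ⟨y.2, congrArg Subtype.val hy⟩) h
    exact ⟨(ShortComplex.homologyMapIso
      (L.isoSc' i n (n + 1) hi (CochainComplex.next _ n))).toLinearEquiv.trans e⟩
  cases n with
  | zero =>
    refine key 0 (CochainComplex.prev_nat_zero) fun e => ?_
    rw [K.shape 0 0 (by simp)]
    constructor
    · intro h
      exact ⟨0, ((Submodule.mem_bot A).1 h).symm⟩
    · rintro ⟨y, rfl⟩
      exact (Submodule.mem_bot A).2 rfl
  | succ n =>
    refine key n (CochainComplex.prev_nat_succ n) fun e => ?_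
    constructor
    · rintro ⟨y, hy, rfl⟩
      exact ⟨⟨y, hy⟩, rfl⟩
    · rintro ⟨y, rfl⟩
      exact ⟨y.1, y.2, rfl⟩

lemma isBaerIn_top_of_injective (E : ModuleCat.{u} A) [Injective E] :
    IsBaerIn (⊤ : Submodule A E) := by
  have h : Module.Injective A E := Module.injective_module_of_injective_object A E
  intro J f _
  obtain ⟨g, hg⟩ := Module.Baer.of_injective h J f
  refine ⟨g 1, trivial, fun y => ?_⟩
  rw [← map_smul, smul_eq_mul, mul_one, hg y.1 y.2]

/-- The local cohomology of `M` with respect to `(a_1,…,a_s)` in degree `s` is the top Čech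
cohomology of `M`. -/
theorem isPowColimit_localCohomologyModule [IsNoetherianRing A] {s : ℕ} (a : Fin s → A) (M : Type u)
    [AddCommGroup M] [Module A M] :
    IsPowColimit (∏ j, a j) (powSubmodule a M)
      (LocalCohomologyModule (Ideal.span (Set.range a)) s M) := by
  obtain ⟨I⟩ := HasInjectiveResolution.out (Z := ModuleCat.of A M)
  let K := I.cocomplex
  have hΓ : (fun i => gammaSubmodule (Ideal.span (Set.range a)) (K.X i)) =
      fun i => jointTorsion a (K.X i) := funext fun i => gammaSubmodule_span_range a _
  have he := nonempty_homology_gammaFunctor_linearEquiv (Ideal.span (Set.range a)) K s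
  rw [hΓ] at he
  obtain ⟨e⟩ := he
  have e' := (I.isoRightDerivedObj (gammaFunctor (Ideal.span (Set.range a))) s).toLinearEquiv
  have hι : Function.Injective (I.ι.f 0).hom := (ModuleCat.mono_iff_injective _).1 inferInstance
  have hker : (ShortComplex.mk _ _ I.ι_f_zero_comp_complex_d).Exact :=
    ShortComplex.exact_of_f_is_kernel _ I.isLimitKernelFork
  rw [ShortComplex.moduleCat_exact_iff] at hker
  refine (cohomology_jointTorsion (E := fun i => K.X i) (d := fun i => (K.d i (i + 1)).hom) ?_ ?_
    (fun i => isBaerIn_top_of_injective _) (I.ι.f 0).hom hι ?_ a).2.of_linearEquiv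
    (e'.trans e).symm
  · intro i z
    exact LinearMap.congr_fun (congrArg ModuleCat.Hom.hom (K.d_comp_d i (i + 1) (i + 2))) z
  · intro i z hz
    exact (ShortComplex.moduleCat_exact_iff _).1 (I.exact_succ i) z hz
  · intro z
    refine ⟨fun hz => hker z hz, ?_⟩
    rintro ⟨m, rfl⟩
    exact LinearMap.congr_fun (congrArg ModuleCat.Hom.hom I.ι_f_zero_comp_complex_d) m

end LocalCohomology

/-! ### The top cohomology of the modified Čech complexes -/

section TopCech

variable {A : Type u} [CommRing A] {t : ℕ} (a : Fin t → A) (M : Type u) [AddCommGroup M] [Module A M]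

/-- The map `m ↦ m / a_S^k`. -/
def fracHom (S : Finset (Fin t)) (k : ℕ) : M →ₗ[A] CechLoc a M S where
  toFun m := frac a S m k
  map_add' m m' := by
    rw [LocalizedModule.mk_add_mk, LocalizedModule.mk_eq]
    exact ⟨1, by simp only [one_smul, Submonoid.smul_def, mul_smul, smul_add]⟩
  map_smul' r m := by rw [RingHom.id_apply, LocalizedModule.smul'_mk]

lemma fracHom_prodElt_smul (S : Finset (Fin t)) (k : ℕ) (m : M) :
    fracHom a M S (k + 1) (prodElt a S • m) = fracHom a M S k m := by
  refine LocalizedModule.mk_eq.2 ⟨1, ?_⟩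
  simp only [one_smul, Submonoid.smul_def, smul_smul, pow_succ]

lemma frac_eq_frac_iff (S : Finset (Fin t)) (k l : ℕ) (m m' : M) :
    frac a S m k = frac a S m' l ↔
      ∃ e : ℕ, prodElt a S ^ (e + l) • m = prodElt a S ^ (e + k) • m' := by
  rw [LocalizedModule.mk_eq]
  constructor
  · rintro ⟨⟨_, e, rfl⟩, h⟩
    refine ⟨e, ?_⟩
    simpa only [Submonoid.smul_def, smul_smul, pow_add] using h
  · rintro ⟨e, h⟩
    refine ⟨⟨_, e, rfl⟩, ?_⟩
    simpa only [Submonoid.smul_def, smul_smul, pow_add] using h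

/-- The submodule of `M_{a_1⋯a_t}` of the fractions `w/(a_1⋯a_t)^k` with
`w ∈ (a_1^k,…,a_t^k)M`. It consists of the coboundaries of the Čech
complex in degree `t`. -/
def fracBoundaries : Submodule A (CechLoc a M Finset.univ) where
  carrier := {z | ∃ k, ∃ w ∈ powSubmodule a M k, fracHom a M Finset.univ k w = z}
  zero_mem' := ⟨0, 0, zero_mem _, map_zero _⟩
  add_mem' := by
    have hp : ∀ k l, ∀ w ∈ powSubmodule a M k,
        prodElt a Finset.univ ^ l • w ∈ powSubmodule a M (k + l) := by
      intro k l w hw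
      induction l with
      | zero => simpa
      | succ l ih =>
        rw [pow_succ', mul_smul]
        exact prod_smul_mem_powSubmodule a _ ih
    rintro _ _ ⟨k, w, hw, rfl⟩ ⟨l, w', hw', rfl⟩
    refine ⟨k + l, prodElt a Finset.univ ^ l • w + prodElt a Finset.univ ^ k • w',
      add_mem (hp _ _ _ hw) (add_comm k l ▸ hp _ _ _ hw'), ?_⟩
    rw [map_add, map_pow_smul_eq (fracHom_prodElt_smul a M _), add_comm k,
      map_pow_smul_eq (fracHom_prodElt_smul a M _)]
  smul_mem' := by
    rintro r _ ⟨k, w, hw, rfl⟩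
    exact ⟨k, r • w, Submodule.smul_mem _ _ hw, map_smul _ _ _⟩

lemma fracHom_mem_fracBoundaries_iff (k : ℕ) (m : M) :
    fracHom a M Finset.univ k m ∈ fracBoundaries a M ↔
      ∃ l, prodElt a Finset.univ ^ l • m ∈ powSubmodule a M (k + l) := by
  constructor
  · rintro ⟨l, w, hw, h⟩
    obtain ⟨e, he⟩ := (frac_eq_frac_iff a M _ _ _ _ _).1 h
    refine ⟨e + l, ?_⟩
    rw [← he, show k + (e + l) = l + (e + k) by omega]
    clear he h
    induction e + k with
    | zero => simpa
    | succ l ih =>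
      rw [pow_succ', mul_smul]
      exact prod_smul_mem_powSubmodule a _ ih
  · rintro ⟨l, hl⟩
    exact ⟨k + l, _, hl, map_pow_smul_eq (fracHom_prodElt_smul a M _) k l m⟩

lemma cechRestrict_erase_fracHom (j : Fin t) (k : ℕ) (m : M) :
    cechRestrict a M (Finset.erase_subset j Finset.univ)
      (fracHom a M (Finset.univ.erase j) k m) = fracHom a M Finset.univ k (a j ^ k • m) := by
  refine (cechRestrict_frac a (Finset.erase_subset j Finset.univ) m k).trans ?_
  have : Finset.univ \ Finset.univ.erase j = {j} := by
    ext i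
    simp
  rw [prodElt, this, Finset.prod_singleton]
  rfl

variable {M} in
/-- A generator `x m/a^k` of `qⁿM[q^c/a]` has its numerator in `q^{n+kc}M`. -/
lemma smul_blowup_le_fracBoundaries {q : Ideal A} {c : Fin t → ℕ} {n : ℕ}
    (hn : ∀ k : ℕ, q ^ (n + k * ∑ j, c j) • (⊤ : Submodule A M) ≤ powSubmodule a M k) :
    q ^ n • blowup a M q c Finset.univ ≤ fracBoundaries a M := by
  refine Submodule.smul_le.2 fun r hr y hy => ?_
  refine (Submodule.span_le.2 ?_ :
    _ ≤ (fracBoundaries a M).comap (LinearMap.lsmul A (CechLoc a M Finset.univ) r)) hy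
  rintro _ ⟨k, x, hx, m, rfl⟩
  refine ⟨k, r • x • m, hn k ?_, map_smul (fracHom a M Finset.univ k) r (x • m)⟩
  rw [smul_smul, pow_add]
  exact Submodule.smul_mem_smul (Ideal.mul_mem_mul hr hx) trivial

/-- The index of the only summand of the Čech complex in degree `t`. -/
abbrev topIndex (t : ℕ) : {S : Finset (Fin t) // S.card = t} := ⟨Finset.univ, by simp⟩

lemma eq_topIndex {t : ℕ} (S : {S : Finset (Fin t) // S.card = t}) : S = topIndex t :=
  Subtype.ext (Finset.card_eq_iff_eq_univ S.1 |>.1 (by simp [S.2]))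

variable {q : Ideal A} {c : Fin t → ℕ} (hac : ∀ i, a i ∈ q ^ c i) (n : ℕ)

/-- The coboundaries of the quotient complex in degree `t` come from those of the Čech complex, as
`qⁿM[q^c/a]` adds nothing to the latter. -/
lemma mk_mem_LBoundaries_iff
    (hn : ∀ k : ℕ, q ^ (n + k * ∑ j, c j) • (⊤ : Submodule A M) ≤ powSubmodule a M k)
    (x : CechTerm a M t) :
    (Submodule.Quotient.mk x : LTerm a M q c n t) ∈ LBoundaries a M n hac t ↔
      x (topIndex t) ∈ fracBoundaries a M := by
  have hle := smul_blowup_le_fracBoundaries a hn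
  constructor
  · intro h
    cases t with
    | zero =>
      have h' : x ∈ modCechTerm a M q c n 0 :=
        (Submodule.Quotient.mk_eq_zero _).1 ((Submodule.mem_bot A).1 h)
      exact hle (mem_modCechTerm.1 h' (topIndex 0))
    | succ t =>
      obtain ⟨y, hy⟩ := h
      obtain ⟨y, rfl⟩ := Submodule.Quotient.mk_surjective _ y
      have h' : cechD a M t y - x ∈ modCechTerm a M q c n (t + 1) :=
        (Submodule.Quotient.eq _).1 hy
      have h1 := hle (mem_modCechTerm.1 h' (topIndex _))
      have h2 : cechD a M t y (topIndex _) ∈ fracBoundaries a M := by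
        rw [cechD_apply]
        refine Submodule.sum_mem _ fun j _ => Submodule.smul_mem _ _ ?_
        obtain ⟨m, k, h⟩ := exists_frac a M _ (y ⟨(topIndex (t + 1)).1.erase j.1,
          by rw [Finset.card_erase_of_mem j.2, (topIndex (t + 1)).2]; rfl⟩)
        rw [h]
        refine ⟨k, a j.1 ^ k • m, Submodule.mem_iSup_of_mem j.1 ⟨m, rfl⟩, ?_⟩
        exact (cechRestrict_erase_fracHom a M j.1 k m).symm
      have h3 := sub_mem h2 h1
      rwa [Pi.sub_apply, sub_sub_cancel] at h3
  · rintro ⟨k, w, hw, h⟩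
    let σ : CechLoc a M Finset.univ →ₗ[A] CechTerm a M t :=
      LinearMap.single A (fun S : {S : Finset (Fin t) // S.card = t} => CechLoc a M S.1)
        (topIndex t)
    have hσ : ∀ z, σ z (topIndex t) = z := fun z => Pi.single_eq_same _ _
    have hx : x = σ (fracHom a M Finset.univ k w) := by
      funext S
      obtain rfl := eq_topIndex S
      exact h.symm.trans (hσ _).symm
    rw [hx]
    refine (iSup_le fun j => ?_ : powSubmodule a M k ≤ (LBoundaries a M n hac t).comap
      (Submodule.mkQ (modCechTerm a M q c n t) ∘ₗ σ ∘ₗ fracHom a M Finset.univ k)) hw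
    rintro _ ⟨m, rfl⟩
    cases t with
    | zero => exact j.elim0
    | succ t =>
      -- up to sign, `m/a_{T∖j}^k` in the summand of `T∖j` is a preimage under the differential
      let S₀ : {S : Finset (Fin (t + 1)) // S.card = t} := ⟨Finset.univ.erase j, by simp⟩
      let s : A := (-1) ^ ((topIndex (t + 1)).1.filter (· < j)).card
      have hs : s * s = 1 := by rw [← pow_add, ← two_mul, pow_mul, neg_one_sq, one_pow]
      let y : CechTerm a M t := Pi.single S₀ (s • fracHom a M (Finset.univ.erase j) k m)
      refine ⟨Submodule.Quotient.mk y, ?_⟩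
      change Submodule.Quotient.mk (cechD a M t y) = Submodule.Quotient.mk _
      refine congrArg _ (funext fun S => ?_)
      obtain rfl := eq_topIndex S
      refine Eq.trans ?_ (hσ (fracHom a M Finset.univ k (a j ^ k • m))).symm
      rw [cechD_apply, Finset.sum_eq_single ⟨j, Finset.mem_univ j⟩]
      · have h2 : y ⟨(topIndex (t + 1)).1.erase j, by simp⟩ =
            s • fracHom a M (Finset.univ.erase j) k m := Pi.single_eq_same _ _
        rw [h2, map_smul, smul_smul]
        refine (congrArg₂ _ hs (cechRestrict_erase_fracHom a M j k m)).trans (one_smul _ _)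
      · rintro ⟨i, hi⟩ - hij
        have h2 : y ⟨(topIndex (t + 1)).1.erase i, by simp⟩ = 0 := by
          refine Pi.single_eq_of_ne (fun h => hij (Subtype.ext ?_)) _
          by_contra hne
          have e : Finset.univ.erase i = Finset.univ.erase j := congrArg Subtype.val h
          have h3 : i ∈ Finset.univ.erase j := Finset.mem_erase.2 ⟨hne, Finset.mem_univ i⟩
          rw [← e] at h3
          exact Finset.notMem_erase i _ h3
        rw [h2, map_zero, smul_zero]
      · intro h
        exact absurd (Finset.mem_univ _) h

/-- If `q^{n+k(c_1+⋯+c_t)}M ⊆ (a_1^k,…,a_t^k)M` for all `k`, then `qⁿM[q^c/a]` consists of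
coboundaries, so the top cohomology of the quotient complex is that of the Čech complex. -/
theorem isPowColimit_LCohomology
    (hn : ∀ k : ℕ, q ^ (n + k * ∑ j, c j) • (⊤ : Submodule A M) ≤ powSubmodule a M k) :
    IsPowColimit (∏ j, a j) (powSubmodule a M) (LCohomology a M n hac t) := by
  have hD : ∀ x : LTerm a M q c n t, x ∈ LinearMap.ker (LD a M n hac t) := by
    intro x
    have : IsEmpty {S : Finset (Fin t) // S.card = t + 1} := ⟨fun S => by
      have := S.1.card_le_univ
      rw [S.2, Fintype.card_fin] at this
      omega⟩
    have : Subsingleton (LTerm a M q c n (t + 1)) := (Submodule.mkQ_surjective _).subsingleton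
    exact Subsingleton.elim _ _
  let σ : CechLoc a M Finset.univ →ₗ[A] CechTerm a M t :=
    LinearMap.single A (fun S : {S : Finset (Fin t) // S.card = t} => CechLoc a M S.1) (topIndex t)
  have hσ : ∀ z, σ z (topIndex t) = z := fun z => Pi.single_eq_same _ _
  let π : CechLoc a M Finset.univ →ₗ[A] LCohomology a M n hac t :=
    Submodule.mkQ _ ∘ₗ (Submodule.mkQ (modCechTerm a M q c n t) ∘ₗ σ).codRestrict _ fun z => hD _
  have hπ : ∀ z, π z = 0 ↔ z ∈ fracBoundaries a M := by
    intro z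
    have := mk_mem_LBoundaries_iff a M hac n hn (σ z)
    rw [hσ] at this
    rw [← this]
    exact Submodule.Quotient.mk_eq_zero _
  refine ⟨fun k => π ∘ₗ fracHom a M Finset.univ k,
    fun k m => congrArg π (fracHom_prodElt_smul a M _ k m), fun z => ?_, fun k m =>
    (hπ _).trans (fracHom_mem_fracBoundaries_iff a M k m)⟩
  obtain ⟨⟨z, hz⟩, rfl⟩ := Submodule.Quotient.mk_surjective _ z
  obtain ⟨x, rfl⟩ := Submodule.Quotient.mk_surjective _ z
  obtain ⟨m, k, h⟩ := exists_frac a M _ (x (topIndex t))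
  refine ⟨k, m, congrArg Submodule.Quotient.mk (Subtype.ext (congrArg Submodule.Quotient.mk ?_))⟩
  funext S
  obtain rfl := eq_topIndex S
  exact (hσ _).trans h.symm

end TopCech

end ModCech

end

theorem mainTheorem3 {A : Type u} [CommRing A] [IsNoetherianRing A] [IsLocalRing A]
    (q : Ideal A) (hq : q ≠ ⊤)
    (M : Type u) [AddCommGroup M] [Module A M] [Module.Finite A M]
    (t : ℕ) (a : Fin t → A) (c : Fin t → ℕ) (hac : ∀ i, a i ∈ q ^ c i)
    (hsop : ModCech.IsSystemOfParameters M a)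
    (hstar : ModCech.ConditionStar M hac) :
    (∃ N : ℕ, ∀ n ≥ N, Nonempty
      (ModCech.LocalCohomologyModule (Ideal.span (Set.range a)) t M ≃ₗ[A]
        ModCech.LCohomology a M n hac t)) ∧
    (Nontrivial (ModCech.LocalCohomologyModule (Ideal.span (Set.range a)) t M) →
      ∃ N : ℕ, ∀ n ≥ N, Nontrivial (ModCech.LCohomology a M n hac t)) := by
  obtain ⟨N, hN⟩ := ModCech.exists_forall_pow_smul_le_iSup hq hac hsop.2.2 hstar
  have h : ∀ n ≥ N, Nonempty
      (ModCech.LocalCohomologyModule (Ideal.span (Set.range a)) t M ≃ₗ[A]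
        ModCech.LCohomology a M n hac t) := fun n hn =>
    (ModCech.isPowColimit_localCohomologyModule a M).nonempty_linearEquiv
      (ModCech.isPowColimit_LCohomology a M hac n (ModCech.pow_smul_le_powSubmodule hN hn))
  refine ⟨⟨N, h⟩, fun _ => ⟨N, fun n hn => ?_⟩⟩
  obtain ⟨e⟩ := h n hn
  exact e.symm.toEquiv.nontrivial
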